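/- A cnf is a finite set of clauses and a dnf a finite set of terms, where a clause or term is a finite set of literals (a variable $x$ or its negation $\neg x$). A set $\beta$ of variables, those set to true, is a model of a cnf if every clause contains a literal that $\beta$ makes true, and a model of a dnf if in some term $\beta$ makes all literals true. For a formula $\varphi$ with set of variables $\mathrm{vars}(\varphi)$ (the variables that occur in $\varphi$) let $\#(\varphi)$ be the number of $\beta\subseteq\mathrm{vars}(\varphi)$ that are models of $\varphi$. Let $\#\mathrm{SAT}$ be the problem of computing $\#(\varphi)$ for a given cnf $\varphi$, and let $\#2\mathrm{SAT}$ (respectively $\#2\mathrm{DNF}$) be the problem of computing $\#(\varphi)$ for a given cnf (respectively dnf) $\varphi$ in which every clause (respectively term) has at most two literals. Formulas are written as words over a finite alphabet in the usual way, with variables named by binary words. A counting problem is a function $P$ that assigns an integer to each of its instances, which are represented by words over a finite alphabet. For counting problems $P$ and $Q$, let $P-Q$ be the counting problem whose instances are the pairs $(x,y)$ of an instance $x$ of $P$ and an instance $y$ of $Q$, with value $P(x)-Q(y)$. Let $[Q]^{\log}$ be the class of all counting problems $P$ that are logspace many-one reducible to $Q$: some function $h$ on words, computed by a deterministic Turing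 machine with a read-only input tape, a write-only output tape and $O(\log n)$ cells of work space on inputs of length $n$, maps every instance $x$ of $P$ to an instance $h(x)$ of $Q$ with $P(x)=Q(h(x))$. Theorem. (1) $\#\mathrm{SAT}\in[\#2\mathrm{SAT}-\#2\mathrm{SAT}]^{\log}$. (2) $[\#2\mathrm{SAT}-\#2\mathrm{SAT}]^{\log}=[\#2\mathrm{DNF}-\#2\mathrm{DNF}]^{\log}$. -/

import Mathlib

/-! ## Propositional formulas in conjunctive and disjunctive normal form -/

/-- Propositional variables are named by words over `{0, 1}`. -/
abbrev PropVar : Type := List Bool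

/-- The literal `(v, true)` is `v` and the literal `(v, false)` is `¬ v`. -/
abbrev PropLiteral : Type := PropVar × Bool

/-- A written-down normal form: a sequence of clauses (for a cnf) or of terms (for a dnf), each of
which is a sequence of literals. Neither the order nor repetitions matter for the notions below,
which only see the underlying set of sets of literals. -/
abbrev NormalForm : Type := List (List PropLiteral)

namespace NormalForm

/-- The set of variables that occur in the formula. -/
def vars (φ : NormalForm) : Finset PropVar :=
  (φ.flatten.map Prod.fst).toFinset

/-- An assignment is the set `β` of the variables that are set to true. -/
def LitTrue (β : Finset PropVar) (l : PropLiteral) : Prop :=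
  if l.2 then l.1 ∈ β else l.1 ∉ β

/-- `β` is a model of the cnf `φ`: every clause has a true literal. -/
def CNFModel (β : Finset PropVar) (φ : NormalForm) : Prop :=
  ∀ c ∈ φ, ∃ l ∈ c, LitTrue β l

/-- `β` is a model of the dnf `φ`: some term has only true literals. -/
def DNFModel (β : Finset PropVar) (φ : NormalForm) : Prop :=
  ∃ t ∈ φ, ∀ l ∈ t, LitTrue β l

open Classical in
/-- The number of models `β ⊆ vars φ` of `φ`, read as a cnf. -/
noncomputable def cnfCount (φ : NormalForm) : ℕ :=
  (φ.vars.powerset.filter fun β => CNFModel β φ).card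

open Classical in
/-- The number of models `β ⊆ vars φ` of `φ`, read as a dnf. -/
noncomputable def dnfCount (φ : NormalForm) : ℕ :=
  (φ.vars.powerset.filter fun β => DNFModel β φ).card

/-- Every clause (or term) consists of at most two literals. -/
def IsTwo (φ : NormalForm) : Prop :=
  ∀ c ∈ φ, c.toFinset.card ≤ 2

/-- The symbols with which formulas are written: `clause` starts a clause (or term), `lit true` and
`lit false` start a positive and a negative literal, and are followed by the bits of the name of
the variable. -/
inductive Symbol : Type
  | clause
  | lit (positive : Bool)
  | bit (b : Bool)
  deriving DecidableEq, Fintype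

/-- The word that represents a literal. -/
def encodeLit (l : PropLiteral) : List Symbol :=
  Symbol.lit l.2 :: l.1.map Symbol.bit

/-- The word that represents a clause (or term). -/
def encodeClause (c : List PropLiteral) : List Symbol :=
  Symbol.clause :: c.flatMap encodeLit

/-- The word that represents a formula. -/
def encode (φ : NormalForm) : List Symbol :=
  φ.flatMap encodeClause

/-- Reads a word from the right; the state holds the bits, the literals and the clauses that are
waiting for the symbol that opens them. -/
def decodeStep (s : Symbol) (a : List Bool × List PropLiteral × NormalForm) :
    List Bool × List PropLiteral × NormalForm :=
  match s with
  | Symbol.bit b => (b :: a.1, a.2.1, a.2.2)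
  | Symbol.lit p => ([], (a.1, p) :: a.2.1, a.2.2)
  | Symbol.clause => ([], [], a.2.1 :: a.2.2)

theorem decode_bits (v : List Bool) (ls : List PropLiteral) (φ : NormalForm) (u : List Bool) :
    List.foldr decodeStep (u, ls, φ) (v.map Symbol.bit) = (v ++ u, ls, φ) := by
  induction v with
  | nil => rfl
  | cons b v ih => simp [ih, decodeStep]

theorem decode_lits (c : List PropLiteral) (φ : NormalForm) :
    List.foldr decodeStep ([], [], φ) (c.flatMap encodeLit) = ([], c, φ) := by
  induction c with
  | nil => rfl
  | cons l c ih =>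
    simp [List.flatMap_cons, List.foldr_append, ih, encodeLit, decode_bits, decodeStep]

theorem decode_encode (φ : NormalForm) :
    List.foldr decodeStep ([], [], []) (encode φ) = ([], [], φ) := by
  induction φ with
  | nil => rfl
  | cons c φ ih =>
    have h : encode (c :: φ) = Symbol.clause :: (c.flatMap encodeLit ++ encode φ) := rfl
    simp [h, List.foldr_append, ih, decode_lits, decodeStep]

theorem encode_injective : Function.Injective encode := by
  intro φ ψ h
  have h1 := decode_encode φ
  rw [h, decode_encode ψ] at h1
  simpa using h1.symm

end NormalForm

/-! ## Logarithmic space -/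

/-- A cell of the input tape, whose two ends are marked. -/
inductive InputCell (α : Type) : Type
  | leftEnd
  | sym (a : α)
  | rightEnd

/-- The possible movements of a head. -/
inductive HeadMove : Type
  | left
  | stay
  | right

/-- What a machine does in one step: it changes its state, moves the head on the input tape, writes
a symbol at the head of each work tape and then moves these heads, and appends at most one symbol
to the output. -/
structure TransducerAction (β State Tape WorkSym : Type) : Type where
  next : State
  inputMove : HeadMove
  write : Tape → WorkSym
  workMove : Tape → HeadMove
  out : Option β

/-- A deterministic Turing machine with a two-way read-only input tape, finitely many work tapes
that are infinite to the right, and a one-way write-only output tape. The transition function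
`delta` sees the state and the scanned symbols; the machine halts when its value is `none`. -/
structure Transducer (α β : Type) : Type 1 where
  State : Type
  Tape : Type
  WorkSym : Type
  finState : Finite State
  finTape : Finite Tape
  finWorkSym : Finite WorkSym
  blank : WorkSym
  start : State
  delta : State → InputCell α → (Tape → WorkSym) → Option (TransducerAction β State Tape WorkSym)

namespace Transducer

variable {α β : Type}

/-- A configuration. The input head is in a position from `0` (left end marker) to `n + 1` (right
end marker), where `n` is the length of the input. -/
structure Cfg (M : Transducer α β) : Type where
  state : M.State
  inputHead : ℕ
  work : M.Tape → ℕ → M.WorkSym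
  workHead : M.Tape → ℕ
  output : List β

/-- The content of the cell `p` of the input tape that carries the word `x`. -/
def inputCell (x : List α) : ℕ → InputCell α
  | 0 => InputCell.leftEnd
  | p + 1 =>
    match x[p]? with
    | some a => InputCell.sym a
    | none => InputCell.rightEnd

/-- A head in position `0` cannot move further to the left. -/
def moveHead : HeadMove → ℕ → ℕ
  | HeadMove.left, p => p - 1
  | HeadMove.stay, p => p
  | HeadMove.right, p => p + 1

/-- The initial configuration: everything is blank, and all heads are in position `0`. -/
def init (M : Transducer α β) : M.Cfg where
  state := M.start
  inputHead := 0
  work := fun _ _ => M.blank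
  workHead := fun _ => 0
  output := []

/-- One step of the machine on the input `x`, or `none` if it halts. The input head cannot move
beyond the right end marker. -/
def step (M : Transducer α β) (x : List α) (c : M.Cfg) : Option M.Cfg :=
  (M.delta c.state (inputCell x c.inputHead) fun k => c.work k (c.workHead k)).map fun a =>
    { state := a.next
      inputHead := min (moveHead a.inputMove c.inputHead) (x.length + 1)
      work := fun k => Function.update (c.work k) (c.workHead k) (a.write k)
      workHead := fun k => moveHead (a.workMove k) (c.workHead k)
      output := c.output ++ a.out.toList }

/-- On the input `x` the machine halts with the output `y`, and visits at most the first `s` cells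
of each work tape. -/
def OutputsInSpace (M : Transducer α β) (x : List α) (y : List β) (s : ℕ) : Prop :=
  (∃ c : M.Cfg, StateTransition.Reaches (M.step x) M.init c ∧ M.step x c = none ∧ c.output = y) ∧
    ∀ c : M.Cfg, StateTransition.Reaches (M.step x) M.init c → ∀ k, c.workHead k < s

end Transducer

/-- The function `h` on words is computed by a deterministic Turing machine whose work space is
`O(log n)` on inputs of length `n`. -/
def LogspaceComputable {α β : Type} (h : List α → List β) : Prop :=
  ∃ (M : Transducer α β) (C : ℕ), ∀ x : List α,
    M.OutputsInSpace x (h x) (C * (Nat.log 2 x.length + 1))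

/-! ## Counting problems and their logspace closures -/

/-- A counting problem assigns an integer to each of its instances, which are represented by words
over a finite alphabet. -/
structure CountingProblem : Type 1 where
  Sym : Type
  finSym : Finite Sym
  Inst : Type
  encode : Inst → List Sym
  encode_injective : Function.Injective encode
  value : Inst → ℤ

namespace CountingProblem

/-- The problem `P - Q`: an instance is a pair that consists of an instance of `P` and one of `Q`,
and its value is the difference of their values. The pair is represented by the two words one after
the other, over the disjoint union of the alphabets. -/
def sub (P Q : CountingProblem) : CountingProblem where
  Sym := P.Sym ⊕ Q.Sym
  finSym := by
    have := P.finSym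
    have := Q.finSym
    infer_instance
  Inst := P.Inst × Q.Inst
  encode := fun z => (P.encode z.1).map Sum.inl ++ (Q.encode z.2).map Sum.inr
  encode_injective := by
    rintro ⟨x, y⟩ ⟨x', y'⟩ h
    have h1 := congrArg (List.filterMap Sum.getLeft?) h
    have h2 := congrArg (List.filterMap Sum.getRight?) h
    simp only [List.filterMap_append, List.filterMap_map] at h1 h2
    have e1 : (Sum.getLeft? ∘ (Sum.inl : P.Sym → P.Sym ⊕ Q.Sym)) = some := rfl
    have e2 : (Sum.getLeft? ∘ (Sum.inr : Q.Sym → P.Sym ⊕ Q.Sym)) = fun _ => none := rfl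
    have e3 : (Sum.getRight? ∘ (Sum.inl : P.Sym → P.Sym ⊕ Q.Sym)) = fun _ => none := rfl
    have e4 : (Sum.getRight? ∘ (Sum.inr : Q.Sym → P.Sym ⊕ Q.Sym)) = some := rfl
    simp [e1, e2] at h1
    simp [e3, e4] at h2
    rw [P.encode_injective h1, Q.encode_injective h2]
  value := fun z => P.value z.1 - Q.value z.2

instance : Sub CountingProblem := ⟨sub⟩

/-- `P` is logspace many-one reducible to `Q`: a function that is computable in logarithmic space
maps each instance of `P` to an instance of `Q` with the same value. -/
def LogspaceReducible (P Q : CountingProblem) : Prop :=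
  ∃ h : List P.Sym → List Q.Sym, LogspaceComputable h ∧
    ∀ x : P.Inst, ∃ y : Q.Inst, h (P.encode x) = Q.encode y ∧ P.value x = Q.value y

/-- The logspace closure `[Q]^log`: all counting problems that are logspace many-one reducible
to `Q`. -/
def logClosure (Q : CountingProblem) : Set CountingProblem :=
  {P | LogspaceReducible P Q}

end CountingProblem

/-- `#SAT`: the number of models of a cnf. -/
noncomputable def sharpSAT : CountingProblem where
  Sym := NormalForm.Symbol
  finSym := inferInstance
  Inst := NormalForm
  encode := NormalForm.encode
  encode_injective := NormalForm.encode_injective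
  value := fun φ => (NormalForm.cnfCount φ : ℤ)

/-- `#2SAT`: the number of models of a cnf with at most two literals in each clause. -/
noncomputable def sharp2SAT : CountingProblem where
  Sym := NormalForm.Symbol
  finSym := inferInstance
  Inst := {φ : NormalForm // NormalForm.IsTwo φ}
  encode := fun φ => NormalForm.encode φ.1
  encode_injective := fun _ _ h => Subtype.ext (NormalForm.encode_injective h)
  value := fun φ => (NormalForm.cnfCount φ.1 : ℤ)

/-- `#2DNF`: the number of models of a dnf with at most two literals in each term. -/
noncomputable def sharp2DNF : CountingProblem where
  Sym := NormalForm.Symbol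
  finSym := inferInstance
  Inst := {φ : NormalForm // NormalForm.IsTwo φ}
  encode := fun φ => NormalForm.encode φ.1
  encode_injective := fun _ _ h => Subtype.ext (NormalForm.encode_injective h)
  value := fun φ => (NormalForm.dnfCount φ.1 : ℤ)

/-! Signed counting turns clauses of arbitrary width into clauses of width two. By inclusion and
exclusion, the indicator that an assignment satisfies a cnf is the sum of (-1)^|S| over all sets S
of clauses falsified by it. That a selected clause is falsified is a conjunction of implications
with two literals each (`selection`). The sign is carried by state bits s_0, s_1, ... with s_{i+1} =
s_i xor (clause i+1 is selected). This equation is not expressible with two literals, but it can be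
weighted. Four fresh variables `mark a b` imply, with two literals per clause, that the states and
the selection are a, b and a xor b. If the equation holds, exactly one mark is free; otherwise all
marks are false. Hence a consistent transition has weight 2 and an inconsistent one weight 1, and
when the sign of the next state is summed, the constant part 1 cancels between its two values
(`sum_link`). Iterating this gives `sum_chain`: the models of the chain, weighted with the sign of
the last state, count models of the cnf with the sign of the first state.

A signed sum is a difference of two plain counts: one formula demands that the last state equals
`signVar`, the other that it differs (`cnfCount_twoCNF_sub`). So every cnf weighted with the signs
of `signVar` and of the first state reduces to #2SAT - #2SAT. Fixing both variables to false yields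
#SAT (`cnfCount_signedCNF`). For a difference of two dnfs, `signVar` chooses which formula is
counted, the variables of the other one being frozen at false, and the sign of the first state forms
1 minus the indicator of the negated dnf (`cnfCount_signedDNF`). From cnfs to dnfs one complements
on a common set of variables, so that the total numbers of assignments cancel
(`dnfCount_complement_sub`).

All formulas are obtained from the given word by symbolwise homomorphisms, concatenation and, for
the numbers in the names of auxiliary variables, a binary counter. Logarithmic space is closed under
these operations (`LogspaceComputable.flatMap`, `append`, `execute`), so composition of arbitrary
logspace functions is not needed. The counter fits because the output length is bounded by the
number of configurations, which is polynomial. -/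

namespace Transducer

/-! ### Runs within a space bound -/

variable {α β γ : Type}

/-- `M.RunsIn x s c d`: on the input `x` the machine gets from `c` to `d`, with all heads on the
first `s` cells of the work tapes in all configurations on the way, including `c` and `d`. -/
inductive RunsIn (M : Transducer α β) (x : List α) (s : ℕ) : M.Cfg → M.Cfg → Prop
  | refl {c : M.Cfg} (hc : ∀ k, c.workHead k < s) : RunsIn M x s c c
  | head {c c' d : M.Cfg} (hc : ∀ k, c.workHead k < s) (h : M.step x c = some c')
      (hd : RunsIn M x s c' d) : RunsIn M x s c d

namespace RunsIn

variable {M : Transducer α β} {x : List α} {s t : ℕ} {c d e : M.Cfg}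

theorem trans (h : M.RunsIn x s c d) (h' : M.RunsIn x s d e) : M.RunsIn x s c e := by
  induction h with
  | refl => exact h'
  | head hc hs _ ih => exact head hc hs (ih h')

theorem mono (h : M.RunsIn x s c d) (hst : s ≤ t) : M.RunsIn x t c d := by
  induction h with
  | refl hc => exact refl fun k => (hc k).trans_le hst
  | head hc hs _ ih => exact head (fun k => (hc k).trans_le hst) hs ih

theorem single (hc : ∀ k, c.workHead k < s) (hd : ∀ k, d.workHead k < s)
    (h : M.step x c = some d) : M.RunsIn x s c d :=
  head hc h (refl hd)

theorem left_lt (h : M.RunsIn x s c d) : ∀ k, c.workHead k < s := by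
  cases h <;> assumption

theorem right_lt (h : M.RunsIn x s c d) : ∀ k, d.workHead k < s := by
  induction h <;> assumption

theorem reaches (h : M.RunsIn x s c d) : StateTransition.Reaches (M.step x) c d := by
  induction h with
  | refl => exact Relation.ReflTransGen.refl
  | head _ hs _ ih => exact Relation.ReflTransGen.head hs ih

/-- Determinism: every configuration reachable from `c` lies on the one run that ends in the halting
configuration `d`. -/
theorem lt_of_reaches (h : M.RunsIn x s c d) (hd : M.step x d = none)
    (he : StateTransition.Reaches (M.step x) c e) : ∀ k, e.workHead k < s := by
  induction h with
  | refl hc =>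
    rcases Relation.ReflTransGen.cases_head he with rfl | ⟨f, hf, -⟩
    · exact hc
    · rw [hd] at hf
      cases hf
  | head hc hs _ ih =>
    rcases Relation.ReflTransGen.cases_head he with rfl | ⟨f, hf, hfe⟩
    · exact hc
    · rw [hs] at hf
      obtain rfl := Option.some_injective _ hf
      exact ih hd hfe

end RunsIn

theorem runsIn_of_reaches {M : Transducer α β} {x : List α} {s : ℕ} {c d : M.Cfg}
    (h : StateTransition.Reaches (M.step x) c d)
    (hs : ∀ e, StateTransition.Reaches (M.step x) c e → ∀ k, e.workHead k < s) :
    M.RunsIn x s c d := by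
  induction h using Relation.ReflTransGen.head_induction_on with
  | refl => exact .refl (hs _ Relation.ReflTransGen.refl)
  | head h' _ ih =>
    exact .head (hs _ Relation.ReflTransGen.refl) h' (ih fun e he => hs e (.head h' he))

theorem outputsInSpace_iff {M : Transducer α β} {x : List α} {y : List β} {s : ℕ} :
    M.OutputsInSpace x y s ↔
      ∃ c, M.RunsIn x s M.init c ∧ M.step x c = none ∧ c.output = y := by
  constructor
  · rintro ⟨⟨c, hc, hn, ho⟩, hs⟩
    exact ⟨c, runsIn_of_reaches hc hs, hn, ho⟩
  · rintro ⟨c, hc, hn, ho⟩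
    exact ⟨⟨c, hc.reaches, hn, ho⟩, fun e he => hc.lt_of_reaches hn he⟩

/-- The symbols scanned on the work tapes. -/
def Cfg.scanned {M : Transducer α β} (c : M.Cfg) (k : M.Tape) : M.WorkSym :=
  c.work k (c.workHead k)

/-- The effect of an action on a configuration. -/
def Cfg.perform {M : Transducer α β} (x : List α) (c : M.Cfg)
    (a : TransducerAction β M.State M.Tape M.WorkSym) : M.Cfg where
  state := a.next
  inputHead := min (moveHead a.inputMove c.inputHead) (x.length + 1)
  work := fun k => Function.update (c.work k) (c.workHead k) (a.write k)
  workHead := fun k => moveHead (a.workMove k) (c.workHead k)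
  output := c.output ++ a.out.toList

theorem step_eq (M : Transducer α β) (x : List α) (c : M.Cfg) :
    M.step x c = (M.delta c.state (inputCell x c.inputHead) c.scanned).map (c.perform x) := rfl

theorem step_eq_none_iff {M : Transducer α β} {x : List α} {c : M.Cfg} :
    M.step x c = none ↔ M.delta c.state (inputCell x c.inputHead) c.scanned = none := by
  rw [step_eq, Option.map_eq_none_iff]

theorem step_eq_some_iff {M : Transducer α β} {x : List α} {c d : M.Cfg} :
    M.step x c = some d ↔
      ∃ a, M.delta c.state (inputCell x c.inputHead) c.scanned = some a ∧ c.perform x a = d := by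
  rw [step_eq, Option.map_eq_some_iff]

/-- A property that holds at the start and is preserved by steps holds along a run. -/
theorem RunsIn.invariant {M : Transducer α β} {x : List α} {s : ℕ} {c d : M.Cfg}
    (p : M.Cfg → Prop) (hp : ∀ c c', p c → (∀ k, c.workHead k < s) → M.step x c = some c' → p c')
    (h : M.RunsIn x s c d) (hc : p c) : p d := by
  induction h with
  | refl => exact hc
  | head hl hs _ ih => exact ih (hp _ _ hc hl hs)

theorem RunsIn.inputHead_le {M : Transducer α β} {x : List α} {s : ℕ} {c d : M.Cfg}
    (h : M.RunsIn x s c d) (hc : c.inputHead ≤ x.length + 1) : d.inputHead ≤ x.length + 1 := by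
  refine h.invariant (fun c => c.inputHead ≤ x.length + 1) ?_ hc
  intro c c' _ _ hs
  obtain ⟨a, -, rfl⟩ := step_eq_some_iff.1 hs
  exact min_le_right _ _

theorem output_prefix_of_step {M : Transducer α β} {x : List α} {c d : M.Cfg}
    (h : M.step x c = some d) : c.output <+: d.output := by
  obtain ⟨a, -, rfl⟩ := step_eq_some_iff.1 h
  exact List.prefix_append _ _

theorem RunsIn.output_prefix {M : Transducer α β} {x : List α} {s : ℕ} {c d : M.Cfg}
    (h : M.RunsIn x s c d) : c.output <+: d.output := by
  induction h with
  | refl => exact List.prefix_rfl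
  | head _ hs _ ih => exact (output_prefix_of_step hs).trans ih

/-! ### A bound for the length of the output -/

section Counting

variable {M : Transducer α β} {x : List α} {s : ℕ}

/-- The machine halts after exactly `n` steps. -/
inductive HaltsIn (M : Transducer α β) (x : List α) : ℕ → M.Cfg → Prop
  | zero {c : M.Cfg} (h : M.step x c = none) : HaltsIn M x 0 c
  | succ {n : ℕ} {c d : M.Cfg} (h : M.step x c = some d) (hd : HaltsIn M x n d) :
      HaltsIn M x (n + 1) c

/-- Two configurations that differ at most in the output. -/
def Cfg.SameCore (c d : M.Cfg) : Prop :=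
  c.state = d.state ∧ c.inputHead = d.inputHead ∧ c.work = d.work ∧ c.workHead = d.workHead

theorem Cfg.SameCore.scanned_eq {c d : M.Cfg} (h : c.SameCore d) : c.scanned = d.scanned := by
  obtain ⟨-, -, h3, h4⟩ := h
  funext k
  simp [Cfg.scanned, h3, h4]

theorem Cfg.SameCore.step_none {c d : M.Cfg} (h : c.SameCore d) (hc : M.step x c = none) :
    M.step x d = none := by
  rw [step_eq_none_iff] at hc ⊢
  rwa [← h.scanned_eq, ← h.1, ← h.2.1]

theorem Cfg.SameCore.step_some {c d c' : M.Cfg} (h : c.SameCore d) (hc : M.step x c = some c') :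
    ∃ d', M.step x d = some d' ∧ c'.SameCore d' := by
  obtain ⟨a, ha, rfl⟩ := step_eq_some_iff.1 hc
  refine ⟨d.perform x a, ?_, ?_⟩
  · refine step_eq_some_iff.2 ⟨a, ?_, rfl⟩
    rwa [← h.scanned_eq, ← h.1, ← h.2.1]
  · obtain ⟨-, h2, h3, h4⟩ := h
    simp [SameCore, perform, h2, h3, h4]

/-- The output tape is never read, so two configurations with the same core step in parallel and
halt together. -/
theorem HaltsIn.eq_of_sameCore {n m : ℕ} {c d : M.Cfg} (hc : HaltsIn M x n c)
    (hd : HaltsIn M x m d) (h : c.SameCore d) : n = m := by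
  induction hc generalizing m d with
  | zero hn =>
    cases hd with
    | zero => rfl
    | succ h' =>
      rw [h.step_none hn] at h'
      cases h'
  | succ hs _ ih =>
    obtain ⟨d', hd', hcd⟩ := h.step_some hs
    cases hd with
    | zero h' =>
      rw [hd'] at h'
      cases h'
    | succ h' hh =>
      rw [hd'] at h'
      obtain rfl := Option.some_injective _ h'
      rw [ih hh hcd]

/-- Configurations of a run: the heads are within their bounds, and the rest of the tapes is
blank. -/
def Cfg.Within (x : List α) (s : ℕ) (c : M.Cfg) : Prop :=
  c.inputHead < x.length + 2 ∧ (∀ k, c.workHead k < s) ∧ ∀ k p, s ≤ p → c.work k p = M.blank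

theorem Cfg.Within.step {c d : M.Cfg} (hc : c.Within x s) (h : M.step x c = some d)
    (hd : ∀ k, d.workHead k < s) : d.Within x s := by
  obtain ⟨a, -, rfl⟩ := step_eq_some_iff.1 h
  refine ⟨Nat.lt_succ_of_le (min_le_right _ _), hd, fun k p hp => ?_⟩
  have : p ≠ c.workHead k := ((hc.2.1 k).trans_le hp).ne'
  simp [perform, Function.update_of_ne this, hc.2.2 k p hp]

/-- A step writes at most one symbol, so the output is no longer than the run. The configurations of
the run itself are the witnesses: each number of remaining steps occurs among them. -/
theorem RunsIn.exists_haltsIn {c d : M.Cfg} (h : M.RunsIn x s c d) (hd : M.step x d = none)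
    (hc : c.Within x s) :
    ∃ n, d.output.length ≤ c.output.length + n ∧
      ∀ m ≤ n, ∃ e : M.Cfg, e.Within x s ∧ HaltsIn M x m e := by
  -- The induction also has to know that `c` itself halts after exactly `n` steps.
  suffices H : ∃ n, d.output.length ≤ c.output.length + n ∧ HaltsIn M x n c ∧
      ∀ m ≤ n, ∃ e : M.Cfg, e.Within x s ∧ HaltsIn M x m e by
    obtain ⟨n, h1, -, h2⟩ := H
    exact ⟨n, h1, h2⟩
  induction h with
  | refl _ =>
    refine ⟨0, le_rfl, .zero hd, fun m hm => ⟨_, hc, ?_⟩⟩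
    obtain rfl := Nat.le_zero.1 hm
    exact .zero hd
  | head hl hs hr ih =>
    obtain ⟨n, h1, h2, h3⟩ := ih hd (hc.step hs hr.left_lt)
    refine ⟨n + 1, ?_, .succ hs h2, fun m hm => ?_⟩
    · obtain ⟨a, -, rfl⟩ := step_eq_some_iff.1 hs
      have : a.out.toList.length ≤ 1 := by cases a.out <;> simp
      simp only [Cfg.perform, List.length_append] at h1
      omega
    · rcases Nat.lt_or_ge n m with hnm | hnm
      · obtain rfl : m = n + 1 := by omega
        exact ⟨_, hc, .succ hs h2⟩
      · exact h3 m hnm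

/-- The part of a configuration that determines the further run. -/
def Cfg.key (x : List α) (s : ℕ) (c : M.Cfg) :
    M.State × Fin (x.length + 2) × (M.Tape → Fin s → M.WorkSym) × (M.Tape → Fin (s + 1)) :=
  (c.state, Fin.ofNat _ c.inputHead, fun k p => c.work k p, fun k => Fin.ofNat _ (c.workHead k))

theorem Cfg.sameCore_of_key_eq {c d : M.Cfg} (hc : c.Within x s) (hd : d.Within x s)
    (h : c.key x s = d.key x s) : c.SameCore d := by
  simp only [key, Prod.mk.injEq] at h
  obtain ⟨h1, h2, h3, h4⟩ := h
  refine ⟨h1, ?_, ?_, ?_⟩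
  · have := congrArg Fin.val h2
    simpa [Fin.ofNat, Nat.mod_eq_of_lt hc.1, Nat.mod_eq_of_lt hd.1] using this
  · funext k p
    rcases Nat.lt_or_ge p s with hp | hp
    · exact congrFun (congrFun h3 k) ⟨p, hp⟩
    · rw [hc.2.2 k p hp, hd.2.2 k p hp]
  · funext k
    have := congrArg Fin.val (congrFun h4 k)
    simpa [Fin.ofNat, Nat.mod_eq_of_lt ((hc.2.1 k).trans (Nat.lt_succ_self s)),
      Nat.mod_eq_of_lt ((hd.2.1 k).trans (Nat.lt_succ_self s))] using this

/-- Pigeonhole: configurations with different numbers of remaining steps have different keys, so the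
length of the run is less than the number of keys. Positivity of `s` places the initial heads within
the bound. -/
theorem OutputsInSpace.length_lt {y : List β} (h : M.OutputsInSpace x y s) (hs : 0 < s) :
    y.length < Nat.card M.State * ((x.length + 2) *
      (((Nat.card M.WorkSym ^ s) ^ Nat.card M.Tape) * (s + 1) ^ Nat.card M.Tape)) := by
  have := M.finState
  have := M.finTape
  have := M.finWorkSym
  obtain ⟨c, hc, hn, rfl⟩ := outputsInSpace_iff.1 h
  have hw : M.init.Within x s := ⟨by simp [init], fun k => hs, fun k p _ => rfl⟩
  obtain ⟨n, hlen, hex⟩ := hc.exists_haltsIn hn hw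
  have : Nonempty M.Cfg := ⟨M.init⟩
  choose! e he1 he2 using hex
  have hinj : Function.Injective fun m : Fin (n + 1) => (e m).key x s := by
    intro m m' hmm
    have hm := Nat.lt_succ_iff.1 m.2
    have hm' := Nat.lt_succ_iff.1 m'.2
    exact Fin.ext ((he2 m hm).eq_of_sameCore (he2 m' hm')
      (Cfg.sameCore_of_key_eq (he1 m hm) (he1 m' hm') hmm))
  have hcard := Nat.card_le_card_of_injective _ hinj
  simp only [Nat.card_eq_fintype_card, Fintype.card_fin] at hcard
  simp only [Nat.card_prod, Nat.card_fun, Nat.card_eq_fintype_card, Fintype.card_fin] at hcard ⊢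
  have h0 : M.init.output.length = 0 := rfl
  omega

end Counting

end Transducer

/-- Each factor of the configuration count is at most 2 to a constant multiple of the logarithm; the
constant `C` collects these multiples. -/
theorem LogspaceComputable.exists_length_lt {α β : Type} {h : List α → List β}
    (hh : LogspaceComputable h) :
    ∃ C, ∀ x, (h x).length < 2 ^ (C * (Nat.log 2 x.length + 1)) := by
  obtain ⟨M, C, hM⟩ := hh
  set S := Nat.card M.State
  set W := Nat.card M.WorkSym
  set T := Nat.card M.Tape
  refine ⟨S + 2 + W * (C + 1) * T + (C + 2) * T, fun x => ?_⟩
  set L := Nat.log 2 x.length + 1 with hL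
  have hL1 : 1 ≤ L := Nat.le_add_left _ _
  -- Replacing `C` by `C + 1` makes the space bound positive.
  have hM' : M.OutputsInSpace x (h x) ((C + 1) * L) := by
    obtain ⟨c, hc, hn⟩ := Transducer.outputsInSpace_iff.1 (hM x)
    exact Transducer.outputsInSpace_iff.2 ⟨c, hc.mono (by gcongr; omega), hn⟩
  refine (hM'.length_lt (by positivity)).trans_le ?_
  have e1 : S ≤ 2 ^ (S * L) := Nat.lt_two_pow_self.le.trans
    (by gcongr; exacts [by norm_num, Nat.le_mul_of_pos_right _ hL1])
  have e2 : x.length + 2 ≤ 2 ^ (2 * L) := by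
    have h1 : x.length < 2 ^ L := Nat.lt_pow_succ_log_self (by norm_num) _
    have h2 : 2 ≤ 2 ^ L := Nat.le_self_pow (by omega) 2
    have h3 : 2 ^ (2 * L) = 2 ^ L * 2 ^ L := by rw [two_mul, pow_add]
    nlinarith
  have e3 : (W ^ ((C + 1) * L)) ^ T ≤ 2 ^ (W * (C + 1) * T * L) := by
    have : W ≤ 2 ^ W := Nat.lt_two_pow_self.le
    calc (W ^ ((C + 1) * L)) ^ T ≤ ((2 ^ W) ^ ((C + 1) * L)) ^ T := by gcongr
      _ = 2 ^ (W * (C + 1) * T * L) := by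
        rw [← pow_mul, ← pow_mul]
        congr 1
        ring
  have e4 : ((C + 1) * L + 1) ^ T ≤ 2 ^ ((C + 2) * T * L) := by
    have : (C + 1) * L + 1 ≤ 2 ^ ((C + 2) * L) :=
      Nat.lt_two_pow_self.le.trans (by gcongr; norm_num; nlinarith)
    calc ((C + 1) * L + 1) ^ T ≤ (2 ^ ((C + 2) * L)) ^ T := by gcongr
      _ = 2 ^ ((C + 2) * T * L) := by
        rw [← pow_mul]
        congr 1
        ring
  calc _ ≤ 2 ^ (S * L) * (2 ^ (2 * L) * (2 ^ (W * (C + 1) * T * L) * 2 ^ ((C + 2) * T * L))) := by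
        gcongr
    _ = 2 ^ ((S + 2 + W * (C + 1) * T + (C + 2) * T) * L) := by
        rw [← pow_add, ← pow_add, ← pow_add]
        congr 1
        ring

/-! ### Simulation of one machine by another -/

namespace Transducer

variable {α β γ : Type}

/-- It suffices to simulate single steps. The step hypothesis may use that the output so far is a
prefix of the final output; this is what bounds the counter in `LogspaceComputable.execute`. -/
theorem RunsIn.simulate {M : Transducer α β} {M' : Transducer α γ} {x : List α} {s s' : ℕ}
    {c d : M.Cfg} (tr : M.Cfg → M'.Cfg) (h : M.RunsIn x s c d) (hc : c.inputHead ≤ x.length + 1)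
    (hlt : ∀ c, (∀ k, c.workHead k < s) → ∀ k, (tr c).workHead k < s')
    (hstep : ∀ c c', c.inputHead ≤ x.length + 1 → (∀ k, c.workHead k < s) →
      (∀ k, c'.workHead k < s) → c'.output <+: d.output → M.step x c = some c' →
      M'.RunsIn x s' (tr c) (tr c')) :
    M'.RunsIn x s' (tr c) (tr d) := by
  induction h with
  | refl hl => exact .refl (hlt _ hl)
  | head hl hs hr ih =>
    refine (hstep _ _ hc hl hr.left_lt hr.output_prefix hs).trans (ih ?_ hstep)
    exact (RunsIn.single hl hr.left_lt hs).inputHead_le hc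

/-! ### The identity and single symbols -/

/-- The machine that copies its input. -/
def copy (α : Type) : Transducer α α where
  State := Unit
  Tape := Empty
  WorkSym := Unit
  finState := inferInstance
  finTape := inferInstance
  finWorkSym := inferInstance
  blank := ()
  start := ()
  delta := fun _ cell _ =>
    match cell with
    | .leftEnd => some ⟨(), .right, fun _ => (), fun _ => .stay, none⟩
    | .sym a => some ⟨(), .right, fun _ => (), fun _ => .stay, some a⟩
    | .rightEnd => none

theorem copy_runsIn (x y z : List α) (h : y ++ z = x) (s : ℕ) (w) (v) :
    ∃ c, (copy α).RunsIn x s ⟨(), y.length + 1, w, v, y⟩ c ∧ (copy α).step x c = none ∧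
      c.output = x := by
  induction z generalizing y w v with
  | nil =>
    refine ⟨_, .refl (fun k => k.elim), ?_, by simpa using h⟩
    have : x[y.length]? = none := by simp [← h]
    simp [step_eq_none_iff, inputCell, copy, this]
  | cons a z ih =>
    have hx : x[y.length]? = some a := by simp [← h]
    have hl : y.length < x.length := by simp [← h]
    obtain ⟨c, h1, h2, h3⟩ := ih (y ++ [a]) (by simpa using h)
      (fun k => k.elim) (fun k => k.elim)
    refine ⟨c, .head (fun k => k.elim) (step_eq_some_iff.2
      ⟨⟨(), .right, fun _ => (), fun _ => .stay, some a⟩, ?_, ?_⟩) h1, h2, h3⟩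
    · simp [inputCell, copy, hx]
    · simp only [Cfg.perform, moveHead, List.length_append, List.length_singleton,
        Option.toList_some]
      congr 1
      · omega
      · funext k
        exact k.elim

/-- The machine that outputs one symbol. -/
def emitOne (α : Type) (b : β) : Transducer α β where
  State := Bool
  Tape := Empty
  WorkSym := Unit
  finState := inferInstance
  finTape := inferInstance
  finWorkSym := inferInstance
  blank := ()
  start := true
  delta := fun q _ _ =>
    if q then some ⟨false, .stay, fun _ => (), fun _ => .stay, some b⟩ else none

/-! ### Homomorphisms -/

/-- The machine that replaces each symbol `b` of the output of `M` by `g b`. -/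
def mapOutput (M : Transducer α β) [Finite γ] (N : ℕ) (g : β → List γ)
    (hg : ∀ b, (g b).length ≤ N) : Transducer α γ where
  State := M.State × {l : List γ // l.length ≤ N}
  Tape := M.Tape
  WorkSym := M.WorkSym
  finState := by
    have := M.finState
    have : Finite {l : List γ // l.length ≤ N} := (List.finite_length_le γ N).to_subtype
    infer_instance
  finTape := M.finTape
  finWorkSym := M.finWorkSym
  blank := M.blank
  start := (M.start, ⟨[], Nat.zero_le _⟩)
  delta := fun q cell scan =>
    match q with
    | (q, ⟨[], _⟩) => (M.delta q cell scan).map fun a =>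
        ⟨(a.next, a.out.elim ⟨[], Nat.zero_le _⟩ fun b => ⟨g b, hg b⟩), a.inputMove, a.write,
          a.workMove, none⟩
    | (q, ⟨c :: l, h⟩) =>
        some ⟨(q, ⟨l, (Nat.le_succ _).trans h⟩), .stay, scan, fun _ => .stay, some c⟩

section mapOutput

variable [Finite γ] {N : ℕ} {g : β → List γ} {hg : ∀ b, (g b).length ≤ N} {M : Transducer α β}

/-- The configuration of `M.mapOutput N g hg` that corresponds to `c`, where `l` remains to be
written. -/
def mapOutputCfg (hg : ∀ b, (g b).length ≤ N) (c : M.Cfg) (l : {l : List γ // l.length ≤ N})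
    (y : List γ) : (M.mapOutput N g hg).Cfg :=
  ⟨(c.state, l), c.inputHead, c.work, c.workHead, y⟩

theorem mapOutput_runsIn_pending {x : List α} {s : ℕ} {c : M.Cfg}
    (hi : c.inputHead ≤ x.length + 1) (hc : ∀ k, c.workHead k < s) (l : List γ) (hl : l.length ≤ N)
    (y : List γ) :
    (M.mapOutput N g hg).RunsIn x s (mapOutputCfg hg c ⟨l, hl⟩ y)
      (mapOutputCfg hg c ⟨[], Nat.zero_le _⟩ (y ++ l)) := by
  induction l generalizing y with
  | nil => simpa using .refl hc
  | cons b l ih =>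
    have := ih ((Nat.le_succ _).trans hl) (y ++ [b])
    rw [List.append_assoc, List.singleton_append] at this
    refine .head hc (step_eq_some_iff.2 ⟨_, rfl, ?_⟩) this
    simp only [Cfg.perform, mapOutputCfg, moveHead, min_eq_left hi, Option.toList_some]
    congr 1
    funext k
    exact Function.update_eq_self _ _

end mapOutput

/-- Machines built from others have a product as work alphabet, and on each tape only one component
is in use; this lemma and the next treat a write to that component. -/
theorem update_pair_left {A B : Type} (f : ℕ → A) (b : B) (p : ℕ) (v : A) :
    Function.update (fun i => (f i, b)) p (v, b) = fun i => (Function.update f p v i, b) := by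
  funext i
  rcases eq_or_ne i p with rfl | hi
  · simp
  · simp [Function.update_of_ne hi]

theorem update_pair_right {A B : Type} (f : ℕ → A) (b : B) (p : ℕ) (v : A) :
    Function.update (fun i => (b, f i)) p (b, v) = fun i => (b, Function.update f p v i) := by
  funext i
  rcases eq_or_ne i p with rfl | hi
  · simp
  · simp [Function.update_of_ne hi]

/-! ### Two outputs one after the other -/

/-- The action that only changes the state and moves the input head. -/
def silentAction {β State Tape WorkSym : Type} (q : State) (m : HeadMove)
    (scan : Tape → WorkSym) : TransducerAction β State Tape WorkSym :=
  ⟨q, m, scan, fun _ => .stay, none⟩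

theorem Cfg.perform_silentAction {M : Transducer α β} {x : List α} (c : M.Cfg) (q : M.State)
    (m : HeadMove) :
    c.perform x (silentAction q m c.scanned) =
      ⟨q, min (moveHead m c.inputHead) (x.length + 1), c.work, c.workHead, c.output⟩ := by
  simp only [perform, silentAction, moveHead, Option.toList_none, List.append_nil]
  congr 1
  funext k
  exact Function.update_eq_self _ _

/-- The machine that runs `M`, returns to the start of the input, and runs `M'`. -/
def andThen (M M' : Transducer α β) : Transducer α β where
  State := M.State ⊕ Option M'.State
  Tape := M.Tape ⊕ M'.Tape
  WorkSym := M.WorkSym × M'.WorkSym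
  finState := by
    have := M.finState
    have := M'.finState
    infer_instance
  finTape := by
    have := M.finTape
    have := M'.finTape
    infer_instance
  finWorkSym := by
    have := M.finWorkSym
    have := M'.finWorkSym
    infer_instance
  blank := (M.blank, M'.blank)
  start := .inl M.start
  delta := fun q cell scan =>
    match q with
    | .inl q =>
      match M.delta q cell fun k => (scan (.inl k)).1 with
      | some a => some ⟨.inl a.next, a.inputMove,
          Sum.elim (fun k => (a.write k, M'.blank)) fun k => scan (.inr k),
          Sum.elim a.workMove fun _ => .stay, a.out⟩
      | none => some (silentAction (.inr none) .stay scan)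
    | .inr none =>
      match cell with
      | .leftEnd => some (silentAction (.inr (some M'.start)) .stay scan)
      | _ => some (silentAction (.inr none) .left scan)
    | .inr (some q) =>
      (M'.delta q cell fun k => (scan (.inr k)).2).map fun a => ⟨.inr (some a.next), a.inputMove,
          Sum.elim (fun k => scan (.inl k)) fun k => (M.blank, a.write k),
          Sum.elim (fun _ => .stay) a.workMove, a.out⟩

section andThen

variable {M M' : Transducer α β} {x : List α} {s : ℕ}

/-- The configuration of `M.andThen M'` whose work tapes are those of `c` and `d`. -/
def andThenCfg (c : M.Cfg) (d : M'.Cfg) (q : M.State ⊕ Option M'.State) (p : ℕ) (y : List β) :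
    (M.andThen M').Cfg where
  state := q
  inputHead := p
  work := Sum.elim (fun k i => (c.work k i, M'.blank)) fun k i => (M.blank, d.work k i)
  workHead := Sum.elim c.workHead d.workHead
  output := y

theorem andThenCfg_lt {c : M.Cfg} {d : M'.Cfg} {q : M.State ⊕ Option M'.State} {p : ℕ}
    {y : List β} (hc : ∀ k, c.workHead k < s) (hd : ∀ k, d.workHead k < s) :
    ∀ k, (andThenCfg c d q p y).workHead k < s := by
  rintro (k | k)
  · exact hc k
  · exact hd k

theorem andThen_delta_some {q : M.State} {cell : InputCell α}
    {scan : (M.andThen M').Tape → (M.andThen M').WorkSym}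
    {a : TransducerAction β M.State M.Tape M.WorkSym}
    (h : M.delta q cell (fun k => (scan (.inl k)).1) = some a) :
    (M.andThen M').delta (.inl q) cell scan = some ⟨.inl a.next, a.inputMove,
      Sum.elim (fun k => (a.write k, M'.blank)) fun k => scan (.inr k),
      Sum.elim a.workMove fun _ => .stay, a.out⟩ := by
  simp only [andThen, h]

theorem andThen_delta_none {q : M.State} {cell : InputCell α}
    {scan : (M.andThen M').Tape → (M.andThen M').WorkSym}
    (h : M.delta q cell (fun k => (scan (.inl k)).1) = none) :
    (M.andThen M').delta (.inl q) cell scan = some (silentAction (.inr none) .stay scan) := by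
  simp only [andThen, h]

theorem andThen_step_left {c c' : M.Cfg} {d : M'.Cfg} (h : M.step x c = some c') :
    (M.andThen M').step x (andThenCfg c d (.inl c.state) c.inputHead c.output) =
      some (andThenCfg c' d (.inl c'.state) c'.inputHead c'.output) := by
  obtain ⟨a, ha, rfl⟩ := step_eq_some_iff.1 h
  refine step_eq_some_iff.2 ⟨⟨.inl a.next, a.inputMove,
          Sum.elim (fun k => (a.write k, M'.blank)) fun k => (M.blank, d.scanned k),
          Sum.elim a.workMove fun _ => .stay, a.out⟩, andThen_delta_some ha, ?_⟩
  · simp only [Cfg.perform, andThenCfg]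
    congr 1
    · funext k i
      rcases k with k | k
      · exact congrFun (update_pair_left (c.work k) M'.blank (c.workHead k) (a.write k)) i
      · exact congrFun (Function.update_eq_self _ _) i
    · funext k
      rcases k with k | k <;> rfl

theorem andThen_step_right {c : M.Cfg} {d d' : M'.Cfg} {y : List β} (h : M'.step x d = some d') :
    (M.andThen M').step x (andThenCfg c d (.inr (some d.state)) d.inputHead (y ++ d.output)) =
      some (andThenCfg c d' (.inr (some d'.state)) d'.inputHead (y ++ d'.output)) := by
  obtain ⟨a, ha, rfl⟩ := step_eq_some_iff.1 h
  refine step_eq_some_iff.2 ⟨⟨.inr (some a.next), a.inputMove,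
          Sum.elim (fun k => (c.scanned k, M'.blank)) fun k => (M.blank, a.write k),
          Sum.elim (fun _ => .stay) a.workMove, a.out⟩, Option.map_eq_some_iff.2 ⟨a, ha, rfl⟩, ?_⟩
  · simp only [Cfg.perform, andThenCfg, List.append_assoc]
    congr 1
    · funext k i
      rcases k with k | k
      · exact congrFun (Function.update_eq_self _ _) i
      · exact congrFun (update_pair_right (d.work k) M.blank (d.workHead k) (a.write k)) i
    · funext k
      rcases k with k | k <;> rfl

theorem andThen_step_halt {c : M.Cfg} {d : M'.Cfg} {y : List β} (hi : c.inputHead ≤ x.length + 1)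
    (h : M.step x c = none) :
    (M.andThen M').step x (andThenCfg c d (.inl c.state) c.inputHead y) =
      some (andThenCfg c d (.inr none) c.inputHead y) := by
  rw [step_eq_none_iff] at h
  refine step_eq_some_iff.2 ⟨silentAction (.inr none) .stay _, andThen_delta_none h,
    Cfg.perform_silentAction _ _ _ |>.trans ?_⟩
  · simp [andThenCfg, moveHead, min_eq_left hi]

/-- The left end marker tells the machine when the input head is back in position `0`. -/
theorem andThen_runsIn_rewind {c : M.Cfg} {d : M'.Cfg} {y : List β} (hc : ∀ k, c.workHead k < s)
    (hd : ∀ k, d.workHead k < s) (p : ℕ) (hp : p ≤ x.length + 1) :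
    (M.andThen M').RunsIn x s (andThenCfg c d (.inr none) p y)
      (andThenCfg c d (.inr (some M'.start)) 0 y) := by
  induction p with
  | zero =>
    refine .single (andThenCfg_lt hc hd) (andThenCfg_lt hc hd) (step_eq_some_iff.2
      ⟨silentAction (.inr (some M'.start)) .stay _, rfl,
        Cfg.perform_silentAction _ _ _ |>.trans ?_⟩)
    simp [andThenCfg, moveHead]
  | succ p ih =>
    refine .head (andThenCfg_lt hc hd) (step_eq_some_iff.2 ⟨silentAction (.inr none) .left _, ?_,
      Cfg.perform_silentAction _ _ _ |>.trans ?_⟩) (ih (by omega))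
    · simp only [andThen, andThenCfg, inputCell]
      cases x[p]? <;> rfl
    · have : min p (x.length + 1) = p := by omega
      simp [andThenCfg, moveHead, this]

end andThen

end Transducer

/-! ### Closure properties of logspace functions -/

open Transducer

namespace LogspaceComputable

variable {α β γ : Type}

theorem of_runsIn {h : List α → List β} (M : Transducer α β) (C : ℕ)
    (hM : ∀ x, ∃ c, M.RunsIn x (C * (Nat.log 2 x.length + 1)) M.init c ∧ M.step x c = none ∧
      c.output = h x) : LogspaceComputable h :=
  ⟨M, C, fun x => outputsInSpace_iff.2 (hM x)⟩

theorem exists_runsIn {h : List α → List β} (hh : LogspaceComputable h) :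
    ∃ (M : Transducer α β) (C : ℕ), ∀ C' ≥ C, ∀ x, ∃ c,
      M.RunsIn x (C' * (Nat.log 2 x.length + 1)) M.init c ∧ M.step x c = none ∧
      c.output = h x := by
  obtain ⟨M, C, hM⟩ := hh
  refine ⟨M, C, fun C' hC x => ?_⟩
  obtain ⟨c, h1, h2⟩ := outputsInSpace_iff.1 (hM x)
  exact ⟨c, h1.mono (by gcongr), h2⟩

theorem id : LogspaceComputable (id : List α → List α) := by
  refine of_runsIn (copy α) 1 fun x => ?_
  obtain ⟨c, h1, h2⟩ := copy_runsIn x [] x rfl (1 * (Nat.log 2 x.length + 1))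
    (fun k => k.elim) (fun k => k.elim)
  refine ⟨c, .head (fun k => k.elim) (step_eq_some_iff.2 ⟨_, rfl, ?_⟩) h1, h2⟩
  simp only [Cfg.perform, moveHead, init]
  congr 1
  funext k
  exact k.elim

theorem singleton (b : β) : LogspaceComputable fun _ : List α => [b] := by
  refine of_runsIn (emitOne α b) 1 fun x => ?_
  exact ⟨_, .head (fun k => k.elim) (step_eq_some_iff.2 ⟨_, rfl, rfl⟩) (.refl fun k => k.elim),
    rfl, rfl⟩

theorem flatMap [Finite β] [Finite γ] {h : List α → List β} (hh : LogspaceComputable h)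
    (g : β → List γ) : LogspaceComputable fun x => (h x).flatMap g := by
  obtain ⟨M, C, hM⟩ := hh.exists_runsIn
  -- Over a finite alphabet the images have bounded length, so a pending image can be kept in the
  -- finite state.
  obtain ⟨N, hN⟩ : ∃ N, ∀ b, (g b).length ≤ N := by
    obtain ⟨N, hN⟩ := (Set.finite_range fun b => (g b).length).bddAbove
    exact ⟨N, fun b => hN ⟨b, rfl⟩⟩
  refine of_runsIn (M.mapOutput N g hN) C fun x => ?_
  obtain ⟨c, h1, h2, h3⟩ := hM C le_rfl x
  refine ⟨mapOutputCfg hN c ⟨[], Nat.zero_le _⟩ (c.output.flatMap g), ?_, ?_, ?_⟩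
  · refine h1.simulate (fun c => mapOutputCfg hN c ⟨[], Nat.zero_le _⟩ (c.output.flatMap g))
      (Nat.zero_le _) (fun c hc => hc) fun c c' hi hc hc' _ hs => ?_
    obtain ⟨a, ha, rfl⟩ := step_eq_some_iff.1 hs
    have hi' : (c.perform x a).inputHead ≤ x.length + 1 := min_le_right _ _
    have hp := mapOutput_runsIn_pending (hg := hN) hi' hc'
      (a.out.elim ⟨[], Nat.zero_le _⟩ fun b => ⟨g b, hN b⟩ : {l : List γ // l.length ≤ N}).1
      (a.out.elim ⟨[], Nat.zero_le _⟩ fun b => ⟨g b, hN b⟩ : {l : List γ // l.length ≤ N}).2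
      (c.output.flatMap g)
    have e : (c.perform x a).output.flatMap g = c.output.flatMap g ++
        (a.out.elim ⟨[], Nat.zero_le _⟩ fun b => ⟨g b, hN b⟩ : {l : List γ // l.length ≤ N}).1 := by
      cases h : a.out <;> simp [Cfg.perform, h]
    rw [← e] at hp
    refine .head hc (step_eq_some_iff.2 ⟨⟨(a.next,
      a.out.elim ⟨[], Nat.zero_le _⟩ fun b => ⟨g b, hN b⟩), a.inputMove, a.write, a.workMove, none⟩,
      Option.map_eq_some_iff.2 ⟨a, ha, rfl⟩, ?_⟩) hp
    simp only [Cfg.perform, mapOutputCfg, Option.toList_none, List.append_nil]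
    rfl
  · rw [step_eq_none_iff] at h2 ⊢
    exact Option.map_eq_none_iff.2 h2
  · simp [mapOutputCfg, h3]

theorem append {h h' : List α → List β} (hh : LogspaceComputable h)
    (hh' : LogspaceComputable h') : LogspaceComputable fun x => h x ++ h' x := by
  obtain ⟨M, C, hM⟩ := hh.exists_runsIn
  obtain ⟨M', C', hM'⟩ := hh'.exists_runsIn
  -- The summand `1` keeps the bound positive: the heads of the machine that has not started rest on
  -- cell `0`.
  refine of_runsIn (M.andThen M') (C + C' + 1) fun x => ?_
  obtain ⟨c, h1, h2, h3⟩ := hM (C + C' + 1) (by omega) x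
  obtain ⟨d, h1', h2', h3'⟩ := hM' (C + C' + 1) (by omega) x
  set s := (C + C' + 1) * (Nat.log 2 x.length + 1)
  have hs : 0 < s := by positivity
  have hi : c.inputHead ≤ x.length + 1 := h1.inputHead_le (Nat.zero_le _)
  refine ⟨andThenCfg c d (.inr (some d.state)) d.inputHead (c.output ++ d.output), ?_, ?_, ?_⟩
  · have r1 : (M.andThen M').RunsIn x s (M.andThen M').init
        (andThenCfg c M'.init (.inl c.state) c.inputHead c.output) := by
      have e : (M.andThen M').init =
          andThenCfg M.init M'.init (.inl M.init.state) M.init.inputHead M.init.output := by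
        simp only [init, andThenCfg, andThen]
        congr 1
        · funext k i
          rcases k with k | k <;> rfl
        · funext k
          rcases k with k | k <;> rfl
      rw [e]
      refine h1.simulate (fun c => andThenCfg c M'.init (.inl c.state) c.inputHead c.output)
        (Nat.zero_le _) (fun c hc => andThenCfg_lt hc fun k => hs) fun c c' hi hc hc' _ hs' => ?_
      exact .single (andThenCfg_lt hc fun k => hs) (andThenCfg_lt hc' fun k => hs)
        (andThen_step_left hs')
    have r2 : (M.andThen M').RunsIn x s
        (andThenCfg c M'.init (.inl c.state) c.inputHead c.output)
        (andThenCfg c M'.init (.inr (some M'.start)) 0 c.output) :=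
      .head (andThenCfg_lt h1.right_lt fun k => hs) (andThen_step_halt hi h2)
        (andThen_runsIn_rewind h1.right_lt (fun k => hs) _ hi)
    have r3 := h1'.simulate (M' := M.andThen M') (s' := s)
        (fun d => andThenCfg c d (.inr (some d.state)) d.inputHead (c.output ++ d.output))
        (Nat.zero_le _) (fun d hd => andThenCfg_lt h1.right_lt hd) fun d d' hi hd hd' _ hs' =>
          .single (andThenCfg_lt h1.right_lt hd) (andThenCfg_lt h1.right_lt hd')
            (andThen_step_right hs')
    have e : c.output ++ M'.init.output = c.output := List.append_nil _
    rw [e] at r3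
    exact (r1.trans r2).trans r3
  · rw [step_eq_none_iff] at h2' ⊢
    exact Option.map_eq_none_iff.2 h2'
  · simp [andThenCfg, h3, h3']

theorem const [Finite β] (l : List β) : LogspaceComputable fun _ : List α => l := by
  simpa using (singleton (α := α) ()).flatMap fun _ => l

end LogspaceComputable

/-! ### Output with a counter -/

/-- Instructions for writing a word with the help of a counter: write a symbol, write the binary
digits of the counter or of its successor, or increment the counter. -/
inductive CounterInstr (γ : Type) : Type
  | emit (c : γ)
  | digits (succ : Bool)
  | incr

namespace CounterInstr

variable {γ : Type}

instance [Finite γ] : Finite (CounterInstr γ) := by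
  refine Finite.of_surjective (α := γ ⊕ Option Bool)
    (fun z => z.elim emit fun o => o.elim incr digits) ?_
  rintro (c | b | _)
  exacts [⟨.inl c, rfl⟩, ⟨.inr (some b), rfl⟩, ⟨.inr none, rfl⟩]

/-- The value of the counter after the instruction. -/
def next (i : ℕ) : CounterInstr γ → ℕ
  | incr => i + 1
  | _ => i

/-- What the instruction writes. -/
def out (bit : Bool → γ) (i : ℕ) : CounterInstr γ → List γ
  | emit c => [c]
  | digits b => (i + b.toNat).bits.map bit
  | incr => []

/-- The word that is written by a list of instructions, for an initial value of the counter. -/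
def run (bit : Bool → γ) (i : ℕ) : List (CounterInstr γ) → List γ
  | [] => []
  | a :: l => a.out bit i ++ run bit (a.next i) l

/-- The final value of the counter. -/
def final (i : ℕ) (l : List (CounterInstr γ)) : ℕ :=
  l.foldl next i

theorem run_append (bit : Bool → γ) (i : ℕ) (l l' : List (CounterInstr γ)) :
    run bit i (l ++ l') = run bit i l ++ run bit (final i l) l' := by
  induction l generalizing i with
  | nil => rfl
  | cons a l ih => simp [run, ih, final]

theorem final_append_singleton (i : ℕ) (l : List (CounterInstr γ)) (a : CounterInstr γ) :
    final i (l ++ [a]) = a.next (final i l) := by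
  simp [final]

theorem final_le (i : ℕ) (l : List (CounterInstr γ)) : final i l ≤ i + l.length := by
  induction l generalizing i with
  | nil => rfl
  | cons a l ih =>
    refine (ih (a.next i)).trans ?_
    have : a.next i ≤ i + 1 := by cases a <;> simp [next]
    simp only [List.length_cons]
    omega

end CounterInstr

/-- Adds a carry to a number that is given by its binary digits. -/
def addCarry : List Bool → Bool → List Bool
  | [], false => []
  | [], true => [true]
  | b :: l, c => xor b c :: addCarry l (c && b)

/-- `Nat.bits` starts with the least significant digit, so a carry moves from left to right and the
sum can be written in a single pass. -/
theorem addCarry_bits (i : ℕ) (c : Bool) : addCarry i.bits c = (i + c.toNat).bits := by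
  have hfalse : ∀ l, addCarry l false = l := by
    intro l
    induction l with
    | nil => rfl
    | cons b l ih => simp [addCarry, ih]
  cases c with
  | false => simp [hfalse]
  | true =>
    -- This form of the recursion excludes a leading digit zero, which `Nat.bits` would not record.
    induction i using Nat.binaryRec' with
    | zero => simp [addCarry]
    | bit b n h ih =>
      rw [Nat.bits_append_bit _ _ h]
      cases b with
      | false =>
        have : Nat.bit false n + true.toNat = Nat.bit true n := by simp [Nat.bit_val]
        rw [this, Nat.bits_append_bit _ _ (fun _ => rfl)]
        simp [addCarry, hfalse]
      | true =>
        have : Nat.bit true n + true.toNat = Nat.bit false (n + 1) := by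
          simp [Nat.bit_val]
          ring
        rw [this, Nat.bits_append_bit _ _ (by simp)]
        simpa [addCarry] using ih

/-! ### A machine with a binary counter -/

namespace Transducer

variable {α γ : Type}

/-- What a machine does with its counter: nothing, read the digits from left to right, with an
incoming carry and possibly with an update of the digits, or return to the left end. -/
inductive CounterMode : Type
  | idle
  | scan (update carry : Bool)
  | ret
  deriving Fintype

/-- The mode in which an instruction is executed. -/
def CounterMode.ofOut : Option (CounterInstr γ) → CounterMode
  | some (.digits b) => .scan false b
  | some .incr => .scan true true
  | _ => .idle

/-- The head movement at the start of a mode. -/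
def CounterMode.firstMove : CounterMode → HeadMove
  | .idle => .stay
  | _ => .right

/-- The symbol that an instruction writes at once. -/
def emitted : Option (CounterInstr γ) → Option γ
  | some (.emit c) => some c
  | _ => none

/-- The machine that executes the instructions that `M` writes. The counter is kept on an
additional tape, from cell `1` on. -/
def execute (M : Transducer α (CounterInstr γ)) (bit : Bool → γ) : Transducer α γ where
  State := M.State × CounterMode
  Tape := Option M.Tape
  WorkSym := M.WorkSym × Option Bool
  finState := by
    have := M.finState
    infer_instance
  finTape := by
    have := M.finTape
    infer_instance
  finWorkSym := by
    have := M.finWorkSym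
    infer_instance
  blank := (M.blank, none)
  start := (M.start, .idle)
  delta := fun q cell scan =>
    match q with
    | (q, .idle) => (M.delta q cell fun k => (scan (some k)).1).map fun a =>
        ⟨(a.next, .ofOut a.out), a.inputMove,
          fun k => k.elim (M.blank, (scan none).2) fun k => (a.write k, none),
          fun k => k.elim (CounterMode.ofOut a.out).firstMove a.workMove, emitted a.out⟩
    | (q, .scan upd carry) =>
      match (scan none).2 with
      | some b => some ⟨(q, .scan upd (carry && b)), .stay,
          fun k => k.elim (M.blank, some (if upd then xor b carry else b)) fun k => scan (some k),
          fun k => k.elim .right fun _ => .stay, if upd then none else some (bit (xor b carry))⟩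
      | none => some ⟨(q, .ret), .stay,
          fun k => k.elim (M.blank, if upd && carry then some true else none) fun k =>
            scan (some k),
          fun k => k.elim .left fun _ => .stay, if !upd && carry then some (bit true) else none⟩
    | (q, .ret) =>
      match (scan none).2 with
      | some _ => some ⟨(q, .ret), .stay, scan, fun k => k.elim .left fun _ => .stay, none⟩
      | none => some (silentAction (q, .idle) .stay scan)

/-- The cells of a tape with a counter. -/
def counterCell (l : List Bool) : ℕ → Option Bool
  | 0 => none
  | p + 1 => l[p]?

section execute

variable {M : Transducer α (CounterInstr γ)} {bit : Bool → γ} {x : List α} {s : ℕ}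

/-- The configuration of `M.execute bit` with the work tapes of `c` and a counter. -/
def executeCfg (bit : Bool → γ) (c : M.Cfg) (m : CounterMode) (l : List Bool) (p : ℕ)
    (y : List γ) : (M.execute bit).Cfg where
  state := (c.state, m)
  inputHead := c.inputHead
  work := fun k => k.elim (fun i => (M.blank, counterCell l i)) fun k i => (c.work k i, none)
  workHead := fun k => k.elim p c.workHead
  output := y

theorem executeCfg_lt {c : M.Cfg} {m : CounterMode} {l : List Bool} {p : ℕ} {y : List γ}
    (hc : ∀ k, c.workHead k < s) (hp : p < s) :
    ∀ k, (executeCfg bit c m l p y).workHead k < s := by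
  rintro (_ | k)
  · exact hp
  · exact hc k

/-- An action that concerns only the counter. -/
theorem perform_executeCfg {c : M.Cfg} {m m' : CounterMode} {l l' : List Bool} {p : ℕ}
    {y : List γ} (hi : c.inputHead ≤ x.length + 1) (o : Option Bool) (mv : HeadMove)
    (out : Option γ) (hl : Function.update (counterCell l) p o = counterCell l') :
    (executeCfg bit c m l p y).perform x ⟨(c.state, m'), .stay,
      fun k => k.elim (M.blank, o) fun k => (c.scanned k, none),
      fun k => k.elim mv fun _ => .stay, out⟩ =
    executeCfg bit c m' l' (moveHead mv p) (y ++ out.toList) := by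
  simp only [Cfg.perform, executeCfg, moveHead, min_eq_left hi]
  congr 1
  · funext k
    rcases k with _ | k
    · exact (update_pair_right _ _ _ _).trans
        (congrArg (fun (f : ℕ → Option Bool) i => (M.blank, f i)) hl)
    · exact Function.update_eq_self _ _
  · funext k
    rcases k with _ | k <;> rfl

/-- Cell `0` of the counter tape always stays blank, which marks the end of the way back. -/
theorem execute_runsIn_return {c : M.Cfg} {l : List Bool} {y : List γ}
    (hi : c.inputHead ≤ x.length + 1) (hc : ∀ k, c.workHead k < s) (p : ℕ) (hp : p ≤ l.length)
    (hs : p < s) :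
    (M.execute bit).RunsIn x s (executeCfg bit c .ret l p y) (executeCfg bit c .idle l 0 y) := by
  induction p with
  | zero =>
    refine .single (executeCfg_lt hc hs) (executeCfg_lt hc hs) (step_eq_some_iff.2
      ⟨silentAction (c.state, .idle) .stay _, rfl, Cfg.perform_silentAction _ _ _ |>.trans ?_⟩)
    simp [executeCfg, moveHead, hi]
  | succ p ih =>
    refine .head (executeCfg_lt hc hs) (step_eq_some_iff.2 ⟨⟨(c.state, .ret), .stay,
      fun k => k.elim (M.blank, some l[p]) fun k => (c.scanned k, none),
      fun k => k.elim .left fun _ => .stay, none⟩, ?_,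
      perform_executeCfg hi _ _ _ (l' := l) ?_⟩)
      (by simpa [moveHead] using ih (by omega) (by omega))
    · have h : ((executeCfg bit c .ret l (p + 1) y).scanned none).2 = some l[p] :=
        List.getElem?_eq_getElem hp
      simp only [execute, executeCfg] at h ⊢
      simp only [h]
      congr 2
      funext k
      rcases k with _ | k
      · exact Prod.ext rfl h
      · rfl
    · rw [Function.update_eq_iff]
      exact ⟨(List.getElem?_eq_getElem hp).symm, fun _ _ => rfl⟩

theorem update_counterCell {l₁ l₂ : List Bool} {b b' : Bool} :
    Function.update (counterCell (l₁ ++ b :: l₂)) (l₁.length + 1) (some b') =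
      counterCell (l₁ ++ b' :: l₂) := by
  rw [Function.update_eq_iff]
  refine ⟨by simp [counterCell], ?_⟩
  rintro (_ | p) hp
  · rfl
  · have hp' : p ≠ l₁.length := fun h => hp (by rw [h])
    simp only [counterCell]
    rcases Nat.lt_or_gt_of_ne hp' with h | h
    · simp [List.getElem?_append_left h]
    · obtain ⟨j, rfl⟩ := Nat.exists_eq_add_of_lt h
      simp [List.getElem?_append_right, Nat.add_assoc]

/-- Induction on the digits still to be read: `l₁` has been passed and, in an update, rewritten. The
head is one cell further than the length of `l₁` since digits start in cell `1`; a last carry goes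
to the blank cell after the digits. -/
theorem execute_runsIn_scan {c : M.Cfg} (hi : c.inputHead ≤ x.length + 1)
    (hc : ∀ k, c.workHead k < s) (upd carry : Bool) (l₁ l₂ : List Bool) (y : List γ)
    (hs : l₁.length + l₂.length + 1 < s) :
    (M.execute bit).RunsIn x s
      (executeCfg bit c (.scan upd carry) (l₁ ++ l₂) (l₁.length + 1) y)
      (executeCfg bit c .idle (l₁ ++ if upd then addCarry l₂ carry else l₂) 0
        (y ++ if upd then [] else (addCarry l₂ carry).map bit)) := by
  induction l₂ generalizing l₁ carry y with
  | nil =>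
    have hret := execute_runsIn_return (bit := bit)
      (l := l₁ ++ if upd then addCarry [] carry else [])
      (y := y ++ if upd then [] else (addCarry [] carry).map bit) hi hc l₁.length (by simp)
      (by simp at hs; omega)
    refine .head (executeCfg_lt hc (by simpa using hs)) (step_eq_some_iff.2 ⟨⟨(c.state, .ret),
      .stay, fun k => k.elim (M.blank, if upd && carry then some true else none) fun k =>
        (c.scanned k, none), fun k => k.elim .left fun _ => .stay,
        if !upd && carry then some (bit true) else none⟩, ?_,
      (perform_executeCfg hi _ _ _ (l' := l₁ ++ if upd then addCarry [] carry else []) ?_).trans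
        ?_⟩) hret
    · have h : ((executeCfg bit c (.scan upd carry) (l₁ ++ []) (l₁.length + 1) y).scanned none).2 =
          none := by
        change (l₁ ++ [])[l₁.length]? = none
        simp
      simp only [execute, executeCfg] at h ⊢
      simp only [h]
      rfl
    · rw [Function.update_eq_iff]
      constructor
      · cases upd <;> cases carry <;> simp [counterCell, addCarry]
      · rintro (_ | p) hp
        · rfl
        · have hp' : p ≠ l₁.length := fun h => hp (by rw [h])
          cases upd <;> cases carry <;> simp [counterCell, addCarry]
          rcases Nat.lt_or_gt_of_ne hp' with h | h
          · simp [List.getElem?_append_left h]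
          · rw [List.getElem?_eq_none (by omega), List.getElem?_eq_none (by simp; omega)]
    · cases upd <;> cases carry <;> simp [moveHead, addCarry]
  | cons b l₂ ih =>
    have := ih (carry && b) (l₁ ++ [if upd then xor b carry else b])
      (y ++ (if upd then none else some (bit (xor b carry))).toList)
      (by simp at hs ⊢; omega)
    refine .head (executeCfg_lt hc (by omega)) (step_eq_some_iff.2 ⟨⟨(c.state,
      .scan upd (carry && b)), .stay,
      fun k => k.elim (M.blank, some (if upd then xor b carry else b)) fun k => (c.scanned k, none),
      fun k => k.elim .right fun _ => .stay, if upd then none else some (bit (xor b carry))⟩, ?_,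
      perform_executeCfg hi _ _ _ update_counterCell⟩) ?_
    · have h : ((executeCfg bit c (.scan upd carry) (l₁ ++ b :: l₂) (l₁.length + 1) y).scanned
          none).2 = some b := by
        change (l₁ ++ b :: l₂)[l₁.length]? = some b
        simp
      simp only [execute, executeCfg] at h ⊢
      simp only [h]
      rfl
    · cases upd <;> simpa [moveHead, addCarry] using this

/-- A symbol is emitted in the very step of `M`; the digits and the increment need one additional
pass over the counter and the way back. -/
theorem execute_runsIn_instr {c c' : M.Cfg} (i : ℕ) (y : List γ)
    (hc : ∀ k, c.workHead k < s) (hc' : ∀ k, c'.workHead k < s) (hs : i.bits.length + 1 < s)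
    {a : TransducerAction (CounterInstr γ) M.State M.Tape M.WorkSym}
    (ha : M.delta c.state (inputCell x c.inputHead) c.scanned = some a)
    (h : c.perform x a = c') :
    (M.execute bit).RunsIn x s (executeCfg bit c .idle i.bits 0 y)
      (executeCfg bit c' .idle ((a.out.elim i (·.next i)).bits) 0
        (y ++ a.out.elim [] (·.out bit i))) := by
  have hi : c'.inputHead ≤ x.length + 1 := h ▸ min_le_right _ _
  have h1 : (M.execute bit).step x (executeCfg bit c .idle i.bits 0 y) =
      some (executeCfg bit c' (.ofOut a.out) i.bits
        (moveHead (CounterMode.ofOut a.out).firstMove 0) (y ++ (emitted a.out).toList)) := by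
    refine step_eq_some_iff.2 ⟨⟨(a.next, .ofOut a.out), a.inputMove,
          fun k => k.elim (M.blank, none) fun k => (a.write k, none),
          fun k => k.elim (CounterMode.ofOut a.out).firstMove a.workMove, emitted a.out⟩,
          Option.map_eq_some_iff.2 ⟨a, ha, rfl⟩, ?_⟩
    subst h
    simp only [Cfg.perform, executeCfg]
    congr 1
    · funext k
      rcases k with _ | k
      · exact Function.update_eq_self _ _
      · exact update_pair_left _ _ _ _
    · funext k
      rcases k with _ | k <;> rfl
  refine .head (executeCfg_lt hc (by omega)) h1 ?_
  rcases ho : a.out with _ | (g | b | _)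
  · simpa [CounterMode.ofOut, CounterMode.firstMove, moveHead, emitted] using
      RunsIn.refl (executeCfg_lt (bit := bit) hc' (by omega))
  · simpa [CounterMode.ofOut, CounterMode.firstMove, moveHead, emitted, CounterInstr.next,
      CounterInstr.out] using RunsIn.refl (executeCfg_lt (bit := bit) hc' (by omega))
  · simpa [CounterMode.ofOut, CounterMode.firstMove, moveHead, emitted, CounterInstr.next,
      CounterInstr.out, addCarry_bits] using
      execute_runsIn_scan (bit := bit) hi hc' false b [] i.bits y (by simpa using hs)
  · simpa [CounterMode.ofOut, CounterMode.firstMove, moveHead, emitted, CounterInstr.next,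
      CounterInstr.out, addCarry_bits] using
      execute_runsIn_scan (bit := bit) hi hc' true true [] i.bits y (by simpa using hs)

end execute

end Transducer

open Transducer

theorem LogspaceComputable.execute {α γ : Type} {h : List α → List (CounterInstr γ)}
    (hh : LogspaceComputable h) (bit : Bool → γ) :
    LogspaceComputable fun x => CounterInstr.run bit 0 (h x) := by
  obtain ⟨C₁, hC₁⟩ := hh.exists_length_lt
  obtain ⟨M, C₂, hM⟩ := hh.exists_runsIn
  -- `C₂` accounts for the tapes of `M` and `C₁` for the digits of the counter; the rest covers the
  -- blank cell before the digits and the one after them.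
  refine of_runsIn (M.execute bit) (C₁ + C₂ + 2) fun x => ?_
  obtain ⟨d, h1, h2, h3⟩ := hM C₂ le_rfl x
  set s := (C₁ + C₂ + 2) * (Nat.log 2 x.length + 1) with hs
  have hle : C₂ * (Nat.log 2 x.length + 1) ≤ s := by
    rw [hs]
    gcongr
    omega
  have hs' : C₁ * (Nat.log 2 x.length + 1) + 1 < s := by
    have : s = C₁ * (Nat.log 2 x.length + 1) + C₂ * (Nat.log 2 x.length + 1) +
      2 * Nat.log 2 x.length + 2 := by
      rw [hs]
      ring
    omega
  refine ⟨executeCfg bit d .idle (CounterInstr.final 0 d.output).bits 0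
    (CounterInstr.run bit 0 d.output), ?_, ?_, ?_⟩
  · have key := h1.simulate (M' := M.execute bit) (s' := s)
      (fun c => executeCfg bit c .idle (CounterInstr.final 0 c.output).bits 0
        (CounterInstr.run bit 0 c.output))
      (Nat.zero_le _) (fun c hc => executeCfg_lt (fun k => (hc k).trans_le hle) (by omega))
      fun c c' _ hc hc' hpre hst => ?_
    · convert key using 1
      simp only [init, executeCfg, Transducer.execute]
      congr 1
      · funext k i
        rcases k with _ | k
        · rcases i with _ | i <;> simp [counterCell, CounterInstr.final]
        · rfl
      · funext k
        rcases k with _ | k <;> rfl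
    · obtain ⟨a, ha, hac⟩ := step_eq_some_iff.1 hst
      have hout : c'.output = c.output ++ a.out.toList := by rw [← hac]; rfl
      -- The counter is at most the number of instructions written so far, hence at most the length
      -- of `h x`, and so has at most `C₁ * (Nat.log 2 x.length + 1)` digits.
      have hlen : (CounterInstr.final 0 c.output).bits.length + 1 < s := by
        refine lt_of_le_of_lt (Nat.succ_le_succ ?_) hs'
        rw [Nat.size_eq_bits_len, Nat.size_le]
        refine lt_of_le_of_lt ?_ (hC₁ x)
        have h4 := CounterInstr.final_le 0 c.output
        have h5 := (output_prefix_of_step hst).length_le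
        have h6 := hpre.length_le
        rw [h3] at h6
        omega
      have := execute_runsIn_instr (bit := bit) _ (CounterInstr.run bit 0 c.output)
        (fun k => (hc k).trans_le hle) (fun k => (hc' k).trans_le hle) hlen ha hac
      cases ho : a.out with
      | none => simpa [ho, hout] using this
      | some a' =>
        simpa [ho, hout, CounterInstr.run_append, CounterInstr.final_append_singleton,
          CounterInstr.run] using this
  · rw [step_eq_none_iff] at h2 ⊢
    exact Option.map_eq_none_iff.2 h2
  · simp [executeCfg, h3]

/-! ## Signed counting with clauses of two literals -/

namespace NormalForm

/-- The indicator of a proposition. -/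
noncomputable def ind (p : Prop) : ℤ :=
  open Classical in if p then 1 else 0

/-- The sign of a proposition, negative if it holds. -/
noncomputable def sign (p : Prop) : ℤ :=
  open Classical in if p then -1 else 1

theorem ind_eq_ite (p : Prop) [Decidable p] : ind p = if p then 1 else 0 := by
  unfold ind
  congr

theorem sign_eq_ite (p : Prop) [Decidable p] : sign p = if p then -1 else 1 := by
  unfold sign
  congr

theorem ind_and (p q : Prop) : ind (p ∧ q) = ind p * ind q := by
  classical
  by_cases hp : p <;> by_cases hq : q <;> simp [ind_eq_ite, hp, hq]

theorem sum_powerset_union {A : Type} [DecidableEq A] {V W : Finset A} (h : Disjoint V W)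
    (f : Finset A → ℤ) :
    ∑ β ∈ (V ∪ W).powerset, f β = ∑ β ∈ V.powerset, ∑ γ ∈ W.powerset, f (β ∪ γ) := by
  induction W using Finset.induction_on generalizing f with
  | empty => simp
  | insert a W ha ih =>
    rw [Finset.disjoint_insert_right] at h
    have ha' : a ∉ V ∪ W := by simp [h.1, ha]
    rw [Finset.union_insert, Finset.sum_powerset_insert ha', ih h.2, ih h.2,
      ← Finset.sum_add_distrib]
    refine Finset.sum_congr rfl fun β _ => ?_
    rw [Finset.sum_powerset_insert ha]
    simp [Finset.union_insert]

theorem cast_cnfCount (φ : NormalForm) :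
    (cnfCount φ : ℤ) = ∑ β ∈ φ.vars.powerset, ind (CNFModel β φ) := by
  unfold cnfCount ind
  rw [Finset.card_filter]
  push_cast
  rfl

theorem cast_dnfCount (φ : NormalForm) :
    (dnfCount φ : ℤ) = ∑ β ∈ φ.vars.powerset, ind (DNFModel β φ) := by
  unfold dnfCount ind
  rw [Finset.card_filter]
  push_cast
  rfl

theorem mem_vars {φ : NormalForm} {v : PropVar} : v ∈ φ.vars ↔ ∃ c ∈ φ, ∃ l ∈ c, l.1 = v := by
  simp only [vars, List.mem_toFinset, List.mem_map, List.mem_flatten]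
  constructor
  · rintro ⟨l, ⟨c, hc, hl⟩, rfl⟩
    exact ⟨c, hc, l, hl, rfl⟩
  · rintro ⟨c, hc, l, hl, rfl⟩
    exact ⟨l, ⟨c, hc, hl⟩, rfl⟩

theorem vars_append (φ ψ : NormalForm) : vars (φ ++ ψ) = vars φ ∪ vars ψ := by
  simp [vars, List.toFinset_append]

theorem vars_cons (c : List PropLiteral) (φ : NormalForm) : vars (c :: φ) = vars [c] ∪ vars φ :=
  vars_append [c] φ

theorem cnfModel_append (β : Finset PropVar) (φ ψ : NormalForm) :
    CNFModel β (φ ++ ψ) ↔ CNFModel β φ ∧ CNFModel β ψ := by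
  simp [CNFModel, or_imp, forall_and]

theorem cnfModel_cons (β : Finset PropVar) (c : List PropLiteral) (φ : NormalForm) :
    CNFModel β (c :: φ) ↔ (∃ l ∈ c, LitTrue β l) ∧ CNFModel β φ := by
  simp [CNFModel]

theorem litTrue_congr {β γ : Finset PropVar} {l : PropLiteral} (h : l.1 ∈ β ↔ l.1 ∈ γ) :
    LitTrue β l ↔ LitTrue γ l := by
  simp [LitTrue, h]

theorem litTrue_not (β : Finset PropVar) (v : PropVar) (b : Bool) :
    LitTrue β (v, !b) ↔ ¬ LitTrue β (v, b) := by
  cases b <;> simp [LitTrue]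

theorem cnfModel_congr {β γ : Finset PropVar} {φ : NormalForm}
    (h : ∀ v ∈ φ.vars, v ∈ β ↔ v ∈ γ) : CNFModel β φ ↔ CNFModel γ φ := by
  refine forall₂_congr fun c hc => exists_congr fun l => and_congr_right fun hl => ?_
  exact litTrue_congr (h _ (mem_vars.2 ⟨c, hc, l, hl, rfl⟩))

/-- The sorts of auxiliary variables: `state` carries a sign along the formula, `select` selects a
clause all of whose literals are false, and `mark a b` doubles the models of even parity. -/
inductive AuxSort : Type
  | state
  | select
  | mark (a b : Bool)
  deriving DecidableEq, Fintype

/-- The part of the name of an auxiliary variable that depends on its sort. -/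
def AuxSort.code : AuxSort → List Bool
  | state => [true, false, false, false]
  | select => [true, false, false, true]
  | mark a b => [true, true, a, b]

/-- The auxiliary variables of a sort are numbered. -/
def auxVar (t : AuxSort) (i : ℕ) : PropVar := t.code ++ i.bits

theorem bits_injective : Function.Injective Nat.bits := by
  intro i j h
  refine Nat.eq_of_testBit_eq fun k => ?_
  rw [Nat.testBit_eq_inth, Nat.testBit_eq_inth, h]

/-- All codes of sorts have length four, so a name splits uniquely into code and number. -/
theorem auxVar_inj {t t' : AuxSort} {i i' : ℕ} : auxVar t i = auxVar t' i' ↔ t = t' ∧ i = i' := by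
  constructor
  · intro h
    have : t = t' ∧ i.bits = i'.bits := by
      rcases t with _ | _ | ⟨a, b⟩ <;> rcases t' with _ | _ | ⟨a', b'⟩ <;>
        simp_all [auxVar, AuxSort.code]
    exact ⟨this.1, bits_injective this.2⟩
  · rintro ⟨rfl, rfl⟩
    rfl

theorem auxVar_ne_false_cons (t : AuxSort) (i : ℕ) (v : List Bool) : auxVar t i ≠ false :: v := by
  rcases t with _ | _ | ⟨a, b⟩ <;> simp [auxVar, AuxSort.code]

/-- A literal of an auxiliary variable whose number is a given one or, if the middle component is
`true`, its successor. -/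
abbrev AuxLiteral : Type := (AuxSort × Bool) × Bool

/-- The literal for a given number. -/
def AuxLiteral.atNumber (i : ℕ) (l : AuxLiteral) : PropLiteral :=
  (auxVar l.1.1 (i + l.1.2.toNat), l.2)

/-- The clauses that relate two consecutive states and the selection of the clause between them:
`mark a b` implies that the states are `a` and `b` and that the clause is selected iff they
differ. -/
def linkClauses : List (List AuxLiteral) :=
  [(false, false), (false, true), (true, false), (true, true)].flatMap fun (a, b) =>
    [(((AuxSort.state, false), a) : AuxLiteral), ((AuxSort.state, true), b),
      ((AuxSort.select, true), xor a b)].map fun l => [((AuxSort.mark a b, true), false), l]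

/-- The clauses of the link from the state `i` to the state `i + 1`. -/
def link (i : ℕ) : NormalForm := linkClauses.map fun c => c.map (AuxLiteral.atNumber i)

/-- A selected clause has only false literals. -/
def selection (i : ℕ) (c : List PropLiteral) : NormalForm :=
  c.map fun l => [(auxVar .select i, false), (l.1, !l.2)]

/-- The links for all clauses of a cnf. -/
def chain : ℕ → NormalForm → NormalForm
  | _, [] => []
  | i, c :: χ => link i ++ (selection (i + 1) c ++ chain (i + 1) χ)

/-- The auxiliary variables of a chain, without its first state. -/
def auxVars : ℕ → NormalForm → Finset PropVar
  | _, [] => ∅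
  | i, _ :: χ => Finset.univ.image (auxVar · (i + 1)) ∪ auxVars (i + 1) χ

theorem exists_of_mem_auxVars {i : ℕ} {χ : NormalForm} {v : PropVar} (h : v ∈ auxVars i χ) :
    ∃ t j, i < j ∧ v = auxVar t j := by
  induction χ generalizing i with
  | nil => simp [auxVars] at h
  | cons c χ ih =>
    simp only [auxVars, Finset.mem_union, Finset.mem_image, Finset.mem_univ, true_and] at h
    rcases h with ⟨t, rfl⟩ | h
    · exact ⟨t, i + 1, Nat.lt_succ_self i, rfl⟩
    · obtain ⟨t, j, hj, rfl⟩ := ih h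
      exact ⟨t, j, by omega, rfl⟩

/-- At most one of the four marks can be true, and only if the selection is the xor of the two
states. -/
theorem cnfModel_link (β : Finset PropVar) (i : ℕ) : CNFModel β (link i) ↔
    ∀ a b, auxVar (.mark a b) (i + 1) ∈ β → a = decide (auxVar .state i ∈ β) ∧
      b = decide (auxVar .state (i + 1) ∈ β) ∧ xor a b = decide (auxVar .select (i + 1) ∈ β) := by
  simp only [link, linkClauses, CNFModel, AuxLiteral.atNumber, LitTrue, List.flatMap_cons,
    List.flatMap_nil, List.map_cons, List.map_nil, List.mem_cons, List.not_mem_nil,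
    List.cons_append, List.nil_append, or_false, forall_eq_or_imp, exists_eq_or_imp,
    exists_eq_left, forall_eq, Bool.forall_bool, Bool.toNat_true, Bool.toNat_false, add_zero,
    Bool.false_eq_true, if_true, if_false, Bool.xor_false, Bool.xor_true, Bool.not_true,
    Bool.not_false]
  by_cases h1 : auxVar .state i ∈ β <;> by_cases h2 : auxVar .state (i + 1) ∈ β <;>
    by_cases h3 : auxVar .select (i + 1) ∈ β <;> simp [h1, h2, h3, and_assoc]

theorem cnfModel_selection (β : Finset PropVar) (i : ℕ) (c : List PropLiteral) :
    CNFModel β (selection i c) ↔ (auxVar .select i ∈ β → ¬ ∃ l ∈ c, LitTrue β l) := by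
  simp only [CNFModel, selection, List.mem_map, forall_exists_index, and_imp,
    forall_apply_eq_imp_iff₂, List.mem_cons, List.not_mem_nil, or_false, exists_eq_or_imp,
    exists_eq_left, litTrue_not, not_exists, not_and]
  simp only [LitTrue, Bool.false_eq_true, if_false]
  constructor
  · intro h hs l hl
    exact (h l hl).resolve_left (not_not.2 hs)
  · intro h l hl
    by_cases hs : auxVar .select i ∈ β
    · exact .inr (h hs l hl)
    · exact .inl hs

/-- `s` is the old state, `sat` the truth of the clause, and `T` the set of true variables of the
new stage. For a fixed selection and new state the marks contribute a factor 2 if the new state is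
`s` xor the selection, and 1 otherwise. Summed with the sign of the new state, this leaves the sign
of `s`, negated if the clause is selected. If the clause is true it cannot be selected and the sign
of `s` remains; if it is false, both selections are possible and cancel. -/
theorem sum_link (s sat : Bool) :
    ∑ T : Finset AuxSort, (if (∀ a b, AuxSort.mark a b ∈ T → a = s ∧
      b = decide (AuxSort.state ∈ T) ∧ xor a b = decide (AuxSort.select ∈ T)) ∧ (AuxSort.select ∈ T → ¬ sat = true) then
        (if AuxSort.state ∈ T then (-1 : ℤ) else 1) else 0) =
      (if sat = true then 1 else 0) * if s = true then -1 else 1 := by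
  revert s sat
  decide

end NormalForm

/-! ### Evaluation of the signed sum over a chain -/

namespace NormalForm

theorem vars_link (i : ℕ) :
    vars (link i) = insert (auxVar .state i) (Finset.univ.image (auxVar · (i + 1))) := by
  have hu : (Finset.univ : Finset AuxSort) = {.state, .select, .mark false false, .mark false true,
      .mark true false, .mark true true} := by decide
  ext v
  rw [hu]
  simp only [vars, link, linkClauses, AuxLiteral.atNumber, List.flatMap_cons,
    List.flatMap_nil, List.map_cons, List.map_nil, List.mem_cons, List.not_mem_nil,
    List.cons_append, List.nil_append, or_false, Bool.toNat_true, Bool.toNat_false, add_zero,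
    List.flatten_cons, List.flatten_nil, List.mem_toFinset, Finset.mem_insert, Finset.image_insert,
    Finset.image_singleton, Finset.mem_singleton]
  tauto

theorem mem_vars_selection {i : ℕ} {c : List PropLiteral} {v : PropVar}
    (h : v ∈ vars (selection i c)) : v = auxVar .select i ∨ v ∈ vars [c] := by
  simp only [mem_vars, selection, List.mem_map, exists_exists_and_eq_and, List.mem_cons,
    List.not_mem_nil, or_false, exists_eq_or_imp, exists_eq_left] at h ⊢
  rcases h with ⟨l, hl, rfl | rfl⟩
  · exact .inl rfl
  · exact .inr ⟨l, hl, rfl⟩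

theorem vars_subset_vars_selection {i : ℕ} {c : List PropLiteral} :
    vars [c] ⊆ vars (selection i c) := by
  intro v h
  simp only [mem_vars, selection, List.mem_map, exists_exists_and_eq_and, List.mem_cons,
    List.not_mem_nil, or_false, exists_eq_or_imp, exists_eq_left] at h ⊢
  obtain ⟨l, hl, rfl⟩ := h
  exact ⟨l, hl, .inr rfl⟩

/-- The first state is inserted on both sides because it does not occur in an empty chain. Each link
already contains every auxiliary variable of its stage, so a selection adds only the variables of
its clause. -/
theorem insert_vars_chain (i : ℕ) (χ : NormalForm) :
    insert (auxVar .state i) (vars (chain i χ)) =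
      insert (auxVar .state i) (vars χ ∪ auxVars i χ) := by
  induction χ generalizing i with
  | nil => simp [chain, auxVars]
  | cons c χ ih =>
    have h1 : ∀ t, auxVar t (i + 1) ∈ (Finset.univ : Finset AuxSort).image (auxVar · (i + 1)) :=
      fun t => Finset.mem_image_of_mem _ (Finset.mem_univ _)
    have h2 := Finset.ext_iff.1 (ih (i + 1))
    ext v
    specialize h2 v
    rw [chain, vars_append, vars_append, vars_link, vars_cons, auxVars]
    simp only [Finset.mem_insert, Finset.mem_union] at h2 ⊢
    have h3 : v ∈ vars (selection (i + 1) c) →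
        v ∈ (Finset.univ : Finset AuxSort).image (auxVar · (i + 1)) ∨ v ∈ vars [c] := fun h => by
      rcases mem_vars_selection h with rfl | h
      · exact .inl (h1 _)
      · exact .inr h
    have h4 : v ∈ vars [c] → v ∈ vars (selection (i + 1) c) := fun h => vars_subset_vars_selection h
    have h5 : v = auxVar .state (i + 1) →
        v ∈ (Finset.univ : Finset AuxSort).image (auxVar · (i + 1)) := fun h => h ▸ h1 _
    clear ih h1
    grind

theorem state_mem_auxVars (i : ℕ) (χ : NormalForm) :
    auxVar .state (i + χ.length) ∈ insert (auxVar .state i) (auxVars i χ) := by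
  induction χ generalizing i with
  | nil => simp
  | cons c χ ih =>
    have := ih (i + 1)
    rw [List.length_cons, ← Nat.add_assoc, Nat.add_right_comm]
    simp only [auxVars, Finset.mem_insert, Finset.mem_union, Finset.mem_image, Finset.mem_univ,
      true_and] at this ⊢
    rcases this with h | h
    · exact .inr (.inl ⟨_, h.symm⟩)
    · exact .inr (.inr h)

/-- The models of a chain, weighted with the sign of the last state, count the models of the
formula, weighted with the sign of the first state. -/
theorem sum_chain (i : ℕ) (χ : NormalForm) (β : Finset PropVar)
    (hβ : ∀ t j, i < j → auxVar t j ∉ β) (hχ : ∀ t j, i < j → auxVar t j ∉ vars χ) :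
    ∑ γ ∈ (auxVars i χ).powerset,
        ind (CNFModel (β ∪ γ) (chain i χ)) * sign (auxVar .state (i + χ.length) ∈ β ∪ γ) =
      ind (CNFModel β χ) * sign (auxVar .state i ∈ β) := by
  induction χ generalizing i β with
  | nil => simp [auxVars, chain, CNFModel]
  | cons c χ ih =>
    classical
    set W : Finset PropVar := Finset.univ.image (auxVar · (i + 1)) with hW
    have hdisj : Disjoint W (auxVars (i + 1) χ) := by
      rw [Finset.disjoint_left]
      intro v hv hv'
      obtain ⟨t, -, rfl⟩ := Finset.mem_image.1 hv
      obtain ⟨t', j, hj, h⟩ := exists_of_mem_auxVars hv'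
      have := (auxVar_inj.1 h).2
      omega
    have hχ' : ∀ t j, i + 1 < j → auxVar t j ∉ vars χ := fun t j hj h =>
      hχ t j (by omega) (by rw [vars_cons]; exact Finset.mem_union_right _ h)
    have hc : ∀ t, auxVar t (i + 1) ∉ vars (c :: χ) := fun t => hχ t _ (Nat.lt_succ_self i)
    -- The variables of later stages are summed out first: the first link and the first selection do
    -- not contain them, and the induction hypothesis applies with `β ∪ γ` as the fixed assignment.
    have inner : ∀ γ ∈ W.powerset, ∑ δ ∈ (auxVars (i + 1) χ).powerset,
        ind (CNFModel (β ∪ (γ ∪ δ)) (chain i (c :: χ))) *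
          sign (auxVar .state (i + (c :: χ).length) ∈ β ∪ (γ ∪ δ)) =
        ind (CNFModel (β ∪ γ) (link i)) * ind (CNFModel (β ∪ γ) (selection (i + 1) c)) *
          (ind (CNFModel β χ) * sign (auxVar .state (i + 1) ∈ β ∪ γ)) := by
      intro γ hγ
      rw [Finset.mem_powerset] at hγ
      have hβγ : ∀ t j, i + 1 < j → auxVar t j ∉ β ∪ γ := by
        intro t j hj h
        rcases Finset.mem_union.1 h with h | h
        · exact hβ t j (by omega) h
        · obtain ⟨t', -, h'⟩ := Finset.mem_image.1 (hγ h)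
          have := (auxVar_inj.1 h').2
          omega
      have e : CNFModel β χ ↔ CNFModel (β ∪ γ) χ := by
        refine cnfModel_congr fun v hv => ?_
        have : v ∉ γ := fun h => by
          obtain ⟨t', -, rfl⟩ := Finset.mem_image.1 (hγ h)
          exact hc t' (by rw [vars_cons]; exact Finset.mem_union_right _ hv)
        simp [this]
      rw [e, ← ih (i + 1) (β ∪ γ) hβγ hχ', Finset.mul_sum]
      refine Finset.sum_congr rfl fun δ hδ => ?_
      rw [Finset.mem_powerset] at hδ
      rw [← Finset.union_assoc, chain, cnfModel_append, cnfModel_append, ind_and, ind_and,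
        List.length_cons, Nat.add_comm χ.length, ← Nat.add_assoc, ← mul_assoc, ← mul_assoc]
      have e1 : CNFModel (β ∪ γ ∪ δ) (link i) ↔ CNFModel (β ∪ γ) (link i) := by
        refine cnfModel_congr fun v hv => ?_
        have : v ∉ δ := fun h => by
          obtain ⟨t', j, hj, rfl⟩ := exists_of_mem_auxVars (hδ h)
          rw [vars_link] at hv
          simp only [Finset.mem_insert, Finset.mem_image, auxVar_inj] at hv
          rcases hv with ⟨-, h⟩ | ⟨_, -, -, h⟩ <;> omega
        simp [this]
      have e2 : CNFModel (β ∪ γ ∪ δ) (selection (i + 1) c) ↔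
          CNFModel (β ∪ γ) (selection (i + 1) c) := by
        refine cnfModel_congr fun v hv => ?_
        have : v ∉ δ := fun h => by
          obtain ⟨t', j, hj, rfl⟩ := exists_of_mem_auxVars (hδ h)
          rcases mem_vars_selection hv with h | h
          · have := (auxVar_inj.1 h).2
            omega
          · exact hχ t' j (by omega) (by rw [vars_cons]; exact Finset.mem_union_left _ h)
        simp [this]
      rw [e1, e2]
    -- The assignments of the first stage correspond to sets of sorts, which brings the remaining
    -- sum into the form of `sum_link`.
    have outer : ∀ T : Finset AuxSort,
        ind (CNFModel (β ∪ T.image (auxVar · (i + 1))) (link i)) *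
          ind (CNFModel (β ∪ T.image (auxVar · (i + 1))) (selection (i + 1) c)) *
          (ind (CNFModel β χ) * sign (auxVar .state (i + 1) ∈ β ∪ T.image (auxVar · (i + 1)))) =
        ind (CNFModel β χ) * (if (∀ a b, AuxSort.mark a b ∈ T →
          a = decide (auxVar .state i ∈ β) ∧ b = decide (AuxSort.state ∈ T) ∧
          xor a b = decide (AuxSort.select ∈ T)) ∧
          (AuxSort.select ∈ T → ¬ decide (∃ l ∈ c, LitTrue β l) = true) then
        (if AuxSort.state ∈ T then (-1 : ℤ) else 1) else 0) := by
      intro T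
      have m1 : ∀ t, auxVar t (i + 1) ∈ β ∪ T.image (auxVar · (i + 1)) ↔ t ∈ T := by
        intro t
        simp [hβ t (i + 1) (Nat.lt_succ_self i), auxVar_inj]
      have m2 : auxVar .state i ∈ β ∪ T.image (auxVar · (i + 1)) ↔ auxVar .state i ∈ β := by
        simp [auxVar_inj]
      have m3 : (∃ l ∈ c, LitTrue (β ∪ T.image (auxVar · (i + 1))) l) ↔ ∃ l ∈ c, LitTrue β l := by
        refine exists_congr fun l => and_congr_right fun hl => litTrue_congr ?_
        have : l.1 ∉ T.image (auxVar · (i + 1)) := fun h => by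
          obtain ⟨t, -, h⟩ := Finset.mem_image.1 h
          exact hc t (mem_vars.2 ⟨c, List.mem_cons_self, l, hl, h.symm⟩)
        simp [this]
      rw [mul_left_comm, ← ind_and, cnfModel_link, cnfModel_selection, m3]
      simp only [m1, m2, decide_eq_true_eq]
      congr 1
      rw [ind_eq_ite, sign_eq_ite, ite_mul, one_mul, zero_mul]
    rw [auxVars, sum_powerset_union hdisj, Finset.sum_congr rfl inner, hW, Finset.powerset_image,
      Finset.sum_image (Finset.image_injective (fun t t' h => (auxVar_inj.1 h).1)).injOn,
      Finset.powerset_univ, Finset.sum_congr rfl fun T _ => outer T, ← Finset.mul_sum, sum_link,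
      cnfModel_cons, ind_and, ind_eq_ite (∃ l ∈ c, LitTrue β l),
      sign_eq_ite (auxVar .state i ∈ β)]
    simp only [decide_eq_true_eq]
    ring

/-- The distinguished variable whose sign is compared with that of the last state. -/
def signVar : PropVar := [false]

/-- A formula with at most two literals in each clause: a chain whose last state equals the
variable `signVar`, or differs from it if `b` holds. -/
def twoCNF (b : Bool) (χ : NormalForm) : NormalForm :=
  chain 0 χ ++ [[(auxVar .state χ.length, true), (signVar, b)],
    [(auxVar .state χ.length, false), (signVar, !b)]]

theorem isTwo_of_length {φ : NormalForm} (h : ∀ c ∈ φ, c.length ≤ 2) : IsTwo φ :=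
  fun c hc => (List.toFinset_card_le c).trans (h c hc)

theorem isTwo_twoCNF (b : Bool) (χ : NormalForm) : IsTwo (twoCNF b χ) := by
  have hchain : ∀ i, ∀ c ∈ chain i χ, c.length ≤ 2 := by
    induction χ with
    | nil => simp [chain]
    | cons d χ ih =>
      intro i c hc
      simp only [chain, List.mem_append] at hc
      rcases hc with hc | hc | hc
      · simp only [link, linkClauses, List.map_flatMap, List.mem_flatMap, List.mem_map] at hc
        obtain ⟨_, -, _, ⟨_, -, rfl⟩, rfl⟩ := hc
        simp
      · obtain ⟨_, -, rfl⟩ := List.mem_map.1 hc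
        simp
      · exact ih _ c hc
  refine isTwo_of_length fun c hc => ?_
  simp only [twoCNF, List.mem_append, List.mem_cons, List.not_mem_nil, or_false] at hc
  rcases hc with hc | rfl | rfl
  · exact hchain 0 c hc
  · simp
  · simp

/-- The set does not depend on `b`, so the two counts range over the same assignments and can be
subtracted term by term. The two final clauses supply the first state even if `χ` is empty. -/
theorem vars_twoCNF (b : Bool) (χ : NormalForm) :
    vars (twoCNF b χ) = (vars χ ∪ {signVar, auxVar .state 0}) ∪ auxVars 0 χ := by
  have h1 := Finset.ext_iff.1 (insert_vars_chain 0 χ)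
  have h2 := state_mem_auxVars 0 χ
  have h3 : auxVar .state 0 ∈ vars (twoCNF b χ) := by
    cases χ with
    | nil => simp [twoCNF, vars]
    | cons c χ => simp [twoCNF, vars_append, chain, vars_link]
  have h4 : vars (twoCNF b χ) = vars (chain 0 χ) ∪ {auxVar .state χ.length, signVar} := by
    rw [twoCNF, vars_append]
    congr 1
    ext v
    simp [vars]
  ext v
  specialize h1 v
  rw [h4] at h3 ⊢
  simp only [Finset.mem_union, Finset.mem_insert, Finset.mem_singleton, zero_add] at h1 h2 h3 ⊢
  grind

theorem ind_cnfModel_twoCNF (b : Bool) (χ : NormalForm) (β : Finset PropVar) :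
    ind (CNFModel β (twoCNF b χ)) = ind (CNFModel β (chain 0 χ)) *
      if xor (decide (auxVar .state χ.length ∈ β)) (decide (signVar ∈ β)) = b then 1 else 0 := by
  classical
  rw [twoCNF, cnfModel_append, ind_and]
  congr 1
  rw [ind_eq_ite]
  congr 1
  simp only [CNFModel, List.mem_cons, List.not_mem_nil, or_false, forall_eq_or_imp, forall_eq,
    exists_eq_or_imp, exists_eq_left, LitTrue]
  by_cases h1 : auxVar .state χ.length ∈ β <;> by_cases h2 : signVar ∈ β <;>
    cases b <;> simp [h1, h2]

/-- The models of a cnf, with a sign that depends on two variables, are counted by the difference of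
two formulas with at most two literals in each clause. -/
theorem cnfCount_twoCNF_sub (χ : NormalForm)
    (hχ : ∀ v ∈ vars χ, v = auxVar .state 0 ∨ ∃ w, v = false :: w) :
    (cnfCount (twoCNF false χ) : ℤ) - cnfCount (twoCNF true χ) =
      ∑ β ∈ (vars χ ∪ {signVar, auxVar .state 0}).powerset,
        ind (CNFModel β χ) * (sign (auxVar .state 0 ∈ β) * sign (signVar ∈ β)) := by
  have hV : ∀ t j, 0 < j → auxVar t j ∉ vars χ ∪ {signVar, auxVar .state 0} := by
    intro t j hj h
    simp only [Finset.mem_union, Finset.mem_insert, Finset.mem_singleton] at h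
    have h0 : auxVar t j ≠ auxVar .state 0 := fun h => hj.ne' (auxVar_inj.1 h).2
    rcases h with h | h | h
    · rcases hχ _ h with h | ⟨w, h⟩
      · exact h0 h
      · exact auxVar_ne_false_cons _ _ _ h
    · exact auxVar_ne_false_cons _ _ _ h
    · exact h0 h
  have hdisj : Disjoint (vars χ ∪ {signVar, auxVar .state 0}) (auxVars 0 χ) := by
    rw [Finset.disjoint_left]
    intro v hv hv'
    obtain ⟨t, j, hj, rfl⟩ := exists_of_mem_auxVars hv'
    exact hV t j hj hv
  rw [cast_cnfCount, cast_cnfCount, vars_twoCNF, vars_twoCNF, sum_powerset_union hdisj,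
    sum_powerset_union hdisj, ← Finset.sum_sub_distrib]
  refine Finset.sum_congr rfl fun β hβ => ?_
  rw [Finset.mem_powerset] at hβ
  rw [← mul_assoc, ← sum_chain 0 χ β (fun t j hj h => hV t j hj (hβ h))
    (fun t j hj h => hV t j hj (Finset.mem_union_left _ h)), ← Finset.sum_sub_distrib,
    Finset.sum_mul]
  refine Finset.sum_congr rfl fun γ hγ => ?_
  rw [Finset.mem_powerset] at hγ
  have hs : signVar ∈ β ∪ γ ↔ signVar ∈ β := by
    have : signVar ∉ γ := fun h => by
      obtain ⟨t, j, hj, h⟩ := exists_of_mem_auxVars (hγ h)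
      exact auxVar_ne_false_cons _ _ _ h.symm
    simp [this]
  rw [ind_cnfModel_twoCNF, ind_cnfModel_twoCNF, zero_add, sign_eq_ite, sign_eq_ite, mul_assoc,
    ← mul_sub]
  congr 1
  -- The indicator of equality minus that of inequality is the product of the two signs.
  by_cases h1 : auxVar .state χ.length ∈ β ∪ γ <;> by_cases h2 : signVar ∈ β <;>
    simp [hs, h1, h2]

end NormalForm

namespace NormalForm

open CounterInstr

/-! ### Writing the chain of a formula -/

theorem run_map_emit (i : ℕ) (w : List Symbol) (r : List (CounterInstr Symbol)) :
    run Symbol.bit i (w.map emit ++ r) = w ++ run Symbol.bit i r := by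
  induction w with
  | nil => rfl
  | cons a w ih => simpa [run, out, next] using ih

/-- The instructions that write a literal of an auxiliary variable. -/
def AuxLiteral.instrs (l : AuxLiteral) : List (CounterInstr Symbol) :=
  (Symbol.lit l.2 :: l.1.1.code.map Symbol.bit).map emit ++ [digits l.1.2]

theorem run_auxLiteral (i : ℕ) (l : AuxLiteral) (r : List (CounterInstr Symbol)) :
    run Symbol.bit i (l.instrs ++ r) = encodeLit (l.atNumber i) ++ run Symbol.bit i r := by
  rw [AuxLiteral.instrs, List.append_assoc, run_map_emit]
  simp [run, out, next, encodeLit, AuxLiteral.atNumber, auxVar]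

/-- The instructions that write a clause of literals of auxiliary variables. -/
def clauseInstrs (c : List AuxLiteral) : List (CounterInstr Symbol) :=
  [Symbol.clause].map emit ++ c.flatMap AuxLiteral.instrs

theorem run_clauseInstrs (i : ℕ) (c : List AuxLiteral) (r : List (CounterInstr Symbol)) :
    run Symbol.bit i (clauseInstrs c ++ r) =
      encodeClause (c.map (AuxLiteral.atNumber i)) ++ run Symbol.bit i r := by
  rw [clauseInstrs, List.append_assoc, run_map_emit, encodeClause, List.singleton_append,
    List.cons_append]
  congr 1
  induction c with
  | nil => rfl
  | cons l c ih =>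
    rw [List.flatMap_cons, List.append_assoc, run_auxLiteral, ih, List.map_cons, List.flatMap_cons,
      List.append_assoc]

theorem run_flatMap_clauseInstrs (i : ℕ) (φ : List (List AuxLiteral))
    (r : List (CounterInstr Symbol)) :
    run Symbol.bit i (φ.flatMap clauseInstrs ++ r) =
      encode (φ.map fun c => c.map (AuxLiteral.atNumber i)) ++ run Symbol.bit i r := by
  induction φ with
  | nil => rfl
  | cons c φ ih =>
    rw [List.flatMap_cons, List.append_assoc, run_clauseInstrs, ih, List.map_cons]
    simp [encode]

/-- The instructions that write a chain, for a symbol of the word that represents the formula. -/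
def chainInstrs : Symbol → List (CounterInstr Symbol)
  | .clause => linkClauses.flatMap clauseInstrs ++ [incr]
  | .lit p => clauseInstrs [((.select, false), false)] ++ [emit (.lit !p)]
  | .bit b => [emit (.bit b)]

theorem flatMap_chainInstrs_bits (v : List Bool) :
    (v.map Symbol.bit).flatMap chainInstrs = (v.map Symbol.bit).map emit := by
  induction v with
  | nil => rfl
  | cons b v ih => simpa [chainInstrs] using ih

theorem run_selection (i : ℕ) (c : List PropLiteral) (r : List (CounterInstr Symbol)) :
    run Symbol.bit i ((c.flatMap encodeLit).flatMap chainInstrs ++ r) =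
      encode (selection i c) ++ run Symbol.bit i r := by
  induction c with
  | nil => rfl
  | cons l c ih =>
    rw [List.flatMap_cons, List.flatMap_append, encodeLit, List.flatMap_cons,
      flatMap_chainInstrs_bits, chainInstrs, List.append_assoc, List.append_assoc,
      List.append_assoc, run_clauseInstrs]
    have := run_map_emit i [Symbol.lit !l.2]
    simp only [List.map_cons, List.map_nil] at this
    rw [this, run_map_emit, ih]
    simp [selection, encode, encodeClause, encodeLit, AuxLiteral.atNumber]

/-- The symbol that opens a clause precedes its literals, so the link is written with the number `i`
and the selection, after the increment, with `i + 1`. At the end the counter holds the number of the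
last state. -/
theorem run_chain (i : ℕ) (χ : NormalForm) (r : List (CounterInstr Symbol)) :
    run Symbol.bit i ((encode χ).flatMap chainInstrs ++ r) =
      encode (chain i χ) ++ run Symbol.bit (i + χ.length) r := by
  induction χ generalizing i with
  | nil => rfl
  | cons c χ ih =>
    have h : encode (c :: χ) = Symbol.clause :: (c.flatMap encodeLit ++ encode χ) := rfl
    rw [h, List.flatMap_cons, List.flatMap_append, chainInstrs, List.append_assoc,
      List.append_assoc, List.append_assoc, run_flatMap_clauseInstrs, List.singleton_append, run]
    simp only [out, next, List.nil_append]
    rw [run_selection, ih, List.length_cons, Nat.add_comm χ.length, ← Nat.add_assoc]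
    simp [chain, encode, link]

/-- The instructions that write the last two clauses of `twoCNF b χ`. -/
def endInstrs (b : Bool) : List (CounterInstr Symbol) :=
  clauseInstrs [((.state, false), true)] ++ ((encodeLit (signVar, b)).map emit ++
    (clauseInstrs [((.state, false), false)] ++ ((encodeLit (signVar, !b)).map emit ++ [])))

theorem run_twoCNF (b : Bool) (χ : NormalForm) :
    run Symbol.bit 0 ((encode χ).flatMap chainInstrs ++ endInstrs b) = encode (twoCNF b χ) := by
  rw [run_chain, endInstrs, run_clauseInstrs, run_map_emit, run_clauseInstrs, run_map_emit]
  simp [twoCNF, encode, encodeClause, AuxLiteral.atNumber, run]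

theorem exists_logspaceComputable_twoCNF {α : Type} {h : List α → List Symbol}
    (hh : LogspaceComputable h) (b : Bool) :
    ∃ h' : List α → List Symbol, LogspaceComputable h' ∧
      ∀ x χ, h x = encode χ → h' x = encode (twoCNF b χ) :=
  ⟨_, ((hh.flatMap chainInstrs).append (.const (endInstrs b))).execute Symbol.bit,
    fun x χ hx => by rw [hx, run_twoCNF]⟩

/-! ### Changing names and signs -/

/-- Puts `p` in front of all names, negates all literals if `n` holds, and adds the literals `e` to
all clauses. -/
def relabel (e : List PropLiteral) (p : List Bool) (n : Bool) (φ : NormalForm) : NormalForm :=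
  φ.map fun c => e ++ c.map fun l => (p ++ l.1, xor n l.2)

/-- For each occurrence of a variable, the clause that consists of the literals `e` and of the
variable with `p` in front of its name and with sign `s`. -/
def occurrences (e : List PropLiteral) (p : List Bool) (s : Bool) (φ : NormalForm) : NormalForm :=
  φ.flatten.map fun l => e ++ [(p ++ l.1, s)]

/-- The homomorphism that computes `relabel`. -/
def relabelSymbol (e : List PropLiteral) (p : List Bool) (n : Bool) : Symbol → List Symbol
  | .clause => encodeClause e
  | .lit b => .lit (xor n b) :: p.map .bit
  | .bit b => [.bit b]

/-- The homomorphism that computes `occurrences`. -/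
def occurrencesSymbol (e : List PropLiteral) (p : List Bool) (s : Bool) : Symbol → List Symbol
  | .clause => []
  | .lit _ => encodeClause e ++ .lit s :: p.map .bit
  | .bit b => [.bit b]

theorem flatMap_bits {f : Symbol → List Symbol} (hf : ∀ b, f (.bit b) = [.bit b])
    (v : List Bool) : (v.map Symbol.bit).flatMap f = v.map Symbol.bit := by
  induction v with
  | nil => rfl
  | cons b v ih => simp [hf, ih]

theorem flatMap_relabelSymbol (e : List PropLiteral) (p : List Bool) (n : Bool) (φ : NormalForm) :
    (encode φ).flatMap (relabelSymbol e p n) = encode (relabel e p n φ) := by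
  have hlits : ∀ c : List PropLiteral, (c.flatMap encodeLit).flatMap (relabelSymbol e p n) =
      (c.map fun l => (p ++ l.1, xor n l.2)).flatMap encodeLit := by
    intro c
    induction c with
    | nil => rfl
    | cons l c ih =>
      rw [List.flatMap_cons, List.flatMap_append, ih, encodeLit, List.flatMap_cons,
        flatMap_bits fun _ => rfl]
      simp [relabelSymbol, encodeLit]
  induction φ with
  | nil => rfl
  | cons c φ ih =>
    have h : encode (c :: φ) = Symbol.clause :: (c.flatMap encodeLit ++ encode φ) := rfl
    rw [h, List.flatMap_cons, List.flatMap_append, hlits, ih]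
    simp [relabel, encode, relabelSymbol, encodeClause]

theorem flatMap_occurrencesSymbol (e : List PropLiteral) (p : List Bool) (s : Bool)
    (φ : NormalForm) :
    (encode φ).flatMap (occurrencesSymbol e p s) = encode (occurrences e p s φ) := by
  have hlits : ∀ c : List PropLiteral, (c.flatMap encodeLit).flatMap (occurrencesSymbol e p s) =
      encode (c.map fun l => e ++ [(p ++ l.1, s)]) := by
    intro c
    induction c with
    | nil => rfl
    | cons l c ih =>
      rw [List.flatMap_cons, List.flatMap_append, ih, encodeLit, List.flatMap_cons,
        flatMap_bits fun _ => rfl]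
      simp [occurrencesSymbol, encodeLit, encode, encodeClause]
  induction φ with
  | nil => rfl
  | cons c φ ih =>
    have h : encode (c :: φ) = Symbol.clause :: (c.flatMap encodeLit ++ encode φ) := rfl
    rw [h, List.flatMap_cons, List.flatMap_append, hlits, ih]
    simp [occurrences, encode, occurrencesSymbol]

theorem isTwo_relabel {φ : NormalForm} (p : List Bool) (n : Bool) (h : IsTwo φ) :
    IsTwo (relabel [] p n φ) := by
  intro c hc
  obtain ⟨d, hd, rfl⟩ := List.mem_map.1 hc
  have : (d.map fun l => (p ++ l.1, xor n l.2)).toFinset =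
      d.toFinset.image fun l => (p ++ l.1, xor n l.2) := by
    ext
    simp
  rw [List.nil_append, this]
  exact Finset.card_image_le.trans (h d hd)

theorem isTwo_occurrences (φ : NormalForm) (p : List Bool) (s : Bool) :
    IsTwo (occurrences [] p s φ) := by
  refine isTwo_of_length fun c hc => ?_
  obtain ⟨_, -, rfl⟩ := List.mem_map.1 hc
  simp

theorem isTwo_append {φ ψ : NormalForm} (hφ : IsTwo φ) (hψ : IsTwo ψ) : IsTwo (φ ++ ψ) :=
  fun c hc => (List.mem_append.1 hc).elim (hφ c) (hψ c)

theorem image_subset_vars_relabel (e : List PropLiteral) (p : List Bool) (n : Bool)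
    (φ : NormalForm) : φ.vars.image (p ++ ·) ⊆ vars (relabel e p n φ) := by
  intro v hv
  obtain ⟨w, hw, rfl⟩ := Finset.mem_image.1 hv
  obtain ⟨c, hc, l, hl, rfl⟩ := mem_vars.1 hw
  exact mem_vars.2 ⟨_, List.mem_map_of_mem hc, _,
    List.mem_append_right _ (List.mem_map_of_mem hl), rfl⟩

theorem vars_relabel_subset (e : List PropLiteral) (p : List Bool) (n : Bool) (φ : NormalForm) :
    vars (relabel e p n φ) ⊆ vars [e] ∪ φ.vars.image (p ++ ·) := by
  intro v hv
  obtain ⟨c, hc, l, hl, rfl⟩ := mem_vars.1 hv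
  obtain ⟨d, hd, rfl⟩ := List.mem_map.1 hc
  rcases List.mem_append.1 hl with hl | hl
  · exact Finset.mem_union_left _ (mem_vars.2 ⟨e, List.mem_singleton_self e, l, hl, rfl⟩)
  · obtain ⟨l', hl', rfl⟩ := List.mem_map.1 hl
    exact Finset.mem_union_right _ (Finset.mem_image_of_mem _ (mem_vars.2 ⟨d, hd, l', hl', rfl⟩))

theorem vars_occurrences_subset (e : List PropLiteral) (p : List Bool) (s : Bool)
    (φ : NormalForm) : vars (occurrences e p s φ) ⊆ vars [e] ∪ φ.vars.image (p ++ ·) := by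
  intro v hv
  obtain ⟨c, hc, l, hl, rfl⟩ := mem_vars.1 hv
  obtain ⟨l', hl', rfl⟩ := List.mem_map.1 hc
  rcases List.mem_append.1 hl with hl | hl
  · exact Finset.mem_union_left _ (mem_vars.2 ⟨e, List.mem_singleton_self e, l, hl, rfl⟩)
  · obtain rfl := List.mem_singleton.1 hl
    obtain ⟨d, hd, hld⟩ := List.mem_flatten.1 hl'
    exact Finset.mem_union_right _ (Finset.mem_image_of_mem _ (mem_vars.2 ⟨d, hd, l', hld, rfl⟩))

theorem image_subset_vars_occurrences (e : List PropLiteral) (p : List Bool) (s : Bool)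
    (φ : NormalForm) : φ.vars.image (p ++ ·) ⊆ vars (occurrences e p s φ) := by
  intro v hv
  obtain ⟨w, hw, rfl⟩ := Finset.mem_image.1 hv
  obtain ⟨c, hc, l, hl, rfl⟩ := mem_vars.1 hw
  exact mem_vars.2 ⟨_, List.mem_map_of_mem (List.mem_flatten.2 ⟨c, hc, hl⟩), _,
    List.mem_append_right _ (List.mem_singleton_self _), rfl⟩

theorem vars_relabel_nil (p : List Bool) (n : Bool) (φ : NormalForm) :
    vars (relabel [] p n φ) = φ.vars.image (p ++ ·) :=
  ((vars_relabel_subset _ _ _ _).trans (by simp [vars])).antisymm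
    (image_subset_vars_relabel _ _ _ _)

theorem vars_occurrences_nil (p : List Bool) (s : Bool) (φ : NormalForm) :
    vars (occurrences [] p s φ) = φ.vars.image (p ++ ·) :=
  ((vars_occurrences_subset _ _ _ _).trans (by simp [vars])).antisymm
    (image_subset_vars_occurrences _ _ _ _)

theorem forall_mem_or_left {A : Type} {L : List A} {q : Prop} {r : A → Prop} :
    (∀ a ∈ L, q ∨ r a) ↔ q ∨ ∀ a ∈ L, r a := by
  by_cases hq : q <;> simp [hq]

section Models

variable {α β : Finset PropVar} {p : List Bool}

theorem cnfModel_relabel_false (h : ∀ v, p ++ v ∈ β ↔ v ∈ α) (φ : NormalForm) :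
    CNFModel β (relabel [] p false φ) ↔ CNFModel α φ := by
  have h' : ∀ l : PropLiteral, LitTrue β (p ++ l.1, xor false l.2) ↔ LitTrue α l := by
    rintro ⟨v, b⟩
    cases b <;> simp [LitTrue, h]
  simp only [CNFModel, relabel, List.mem_map, forall_exists_index, and_imp,
    forall_apply_eq_imp_iff₂, List.nil_append, exists_exists_and_eq_and, h']

/-- De Morgan; the literals `e`, being in each clause, switch the whole formula off when one of them
is true. -/
theorem cnfModel_relabel_true (h : ∀ v, p ++ v ∈ β ↔ v ∈ α) (e : List PropLiteral)
    (φ : NormalForm) : CNFModel β (relabel e p true φ) ↔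
      (∃ l ∈ e, LitTrue β l) ∨ ¬ DNFModel α φ := by
  have h' : ∀ l : PropLiteral, LitTrue β (p ++ l.1, xor true l.2) ↔ ¬ LitTrue α l := by
    rintro ⟨v, b⟩
    cases b <;> simp [LitTrue, h]
  simp only [CNFModel, DNFModel, relabel, List.mem_map, forall_exists_index, and_imp,
    forall_apply_eq_imp_iff₂, List.mem_append, or_and_right, exists_or, exists_exists_and_eq_and,
    h', not_exists, not_and, not_forall, exists_prop]
  exact forall_mem_or_left

theorem dnfModel_relabel_true (h : ∀ v, p ++ v ∈ β ↔ v ∈ α) (φ : NormalForm) :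
    DNFModel β (relabel [] p true φ) ↔ ¬ CNFModel α φ := by
  have h' : ∀ l : PropLiteral, LitTrue β (p ++ l.1, xor true l.2) ↔ ¬ LitTrue α l := by
    rintro ⟨v, b⟩
    cases b <;> simp [LitTrue, h]
  simp only [CNFModel, DNFModel, relabel, List.mem_map, exists_exists_and_eq_and, List.nil_append,
    forall_exists_index, and_imp, forall_apply_eq_imp_iff₂, h', not_forall, not_exists, not_and,
    exists_prop]

/-- Negative unit clauses for all variables of `φ` leave only the empty assignment; as before, `e`
switches this off. -/
theorem cnfModel_occurrences_false (h : ∀ v, p ++ v ∈ β ↔ v ∈ α) (e : List PropLiteral)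
    {φ : NormalForm} (hα : α ⊆ φ.vars) : CNFModel β (occurrences e p false φ) ↔
      (∃ l ∈ e, LitTrue β l) ∨ α = ∅ := by
  simp only [CNFModel, occurrences, List.mem_map, forall_exists_index, and_imp,
    forall_apply_eq_imp_iff₂, List.mem_append, or_and_right, exists_or, List.mem_singleton,
    exists_eq_left, forall_mem_or_left]
  refine or_congr_right ?_
  simp only [LitTrue, Bool.false_eq_true, if_false, h]
  constructor
  · intro hl
    refine Finset.eq_empty_of_forall_notMem fun v hv => ?_
    obtain ⟨c, hc, l, hlc, rfl⟩ := mem_vars.1 (hα hv)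
    exact hl l (List.mem_flatten.2 ⟨c, hc, hlc⟩) hv
  · rintro rfl l -
    exact Finset.notMem_empty _

theorem dnfModel_occurrences_true (h : ∀ v, p ++ v ∈ β ↔ v ∈ α) {φ : NormalForm}
    (hα : α ⊆ φ.vars) : DNFModel β (occurrences [] p true φ) ↔ α ≠ ∅ := by
  simp only [DNFModel, occurrences, List.mem_map, exists_exists_and_eq_and, List.nil_append,
    List.mem_singleton, forall_eq, LitTrue, if_true, h]
  rw [← Finset.nonempty_iff_ne_empty]
  constructor
  · rintro ⟨l, -, hl⟩
    exact ⟨_, hl⟩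
  · rintro ⟨v, hv⟩
    obtain ⟨c, hc, l, hlc, rfl⟩ := mem_vars.1 (hα hv)
    exact ⟨l, List.mem_flatten.2 ⟨c, hc, hlc⟩, hv⟩

theorem dnfModel_append (β : Finset PropVar) (φ ψ : NormalForm) :
    DNFModel β (φ ++ ψ) ↔ DNFModel β φ ∨ DNFModel β ψ := by
  simp [DNFModel, or_and_right, exists_or]

end Models

theorem sum_powerset_image (p : List Bool) (V : Finset PropVar) (f : Finset PropVar → ℤ) :
    ∑ β ∈ (V.image (p ++ ·)).powerset, f β = ∑ α ∈ V.powerset, f (α.image (p ++ ·)) := by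
  rw [Finset.powerset_image, Finset.sum_image
    (Finset.image_injective (fun _ _ h => List.append_cancel_left h)).injOn]

theorem append_mem_image {p : List Bool} {v : PropVar} {α : Finset PropVar} :
    p ++ v ∈ α.image (p ++ ·) ↔ v ∈ α := by
  simp

end NormalForm

namespace NormalForm

/-! ### The two reductions to signed counting -/

/-- The prefixes with which the variables of two formulas are made different. -/
def namePrefix (b : Bool) : List Bool := [false, b]

theorem disjoint_image_namePrefix (V W : Finset PropVar) :
    Disjoint (V.image (namePrefix false ++ ·)) (W.image (namePrefix true ++ ·)) := by
  rw [Finset.disjoint_left]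
  intro v hv hv'
  obtain ⟨w, -, rfl⟩ := Finset.mem_image.1 hv
  obtain ⟨w', -, h⟩ := Finset.mem_image.1 hv'
  simp [namePrefix] at h

theorem signVar_notMem_image (b : Bool) (V : Finset PropVar) :
    signVar ∉ V.image (namePrefix b ++ ·) := by
  simp [namePrefix, signVar]

theorem state_notMem_image (b : Bool) (V : Finset PropVar) :
    auxVar .state 0 ∉ V.image (namePrefix b ++ ·) := by
  simp [namePrefix, auxVar, AuxSort.code]

theorem disjoint_image_pair (b : Bool) (V : Finset PropVar) :
    Disjoint (V.image (namePrefix b ++ ·)) {signVar, auxVar .state 0} := by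
  rw [Finset.disjoint_insert_right, Finset.disjoint_singleton_right]
  exact ⟨signVar_notMem_image b V, state_notMem_image b V⟩

theorem signVar_ne_state : signVar ≠ auxVar .state 0 := by
  simp [signVar, auxVar, AuxSort.code]

theorem sum_powerset_pair (f : Finset PropVar → ℤ) :
    ∑ ρ ∈ ({signVar, auxVar .state 0} : Finset PropVar).powerset, f ρ =
      f ∅ + f {auxVar .state 0} + (f {signVar} + f {signVar, auxVar .state 0}) := by
  rw [Finset.sum_powerset_insert (by simpa using signVar_ne_state), ← insert_empty_eq,
    Finset.sum_powerset_insert (Finset.notMem_empty _),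
    Finset.sum_powerset_insert (Finset.notMem_empty _)]
  simp

theorem image_of_namePrefix_mem {V : Finset PropVar} {b : Bool} {v : PropVar}
    (h : v ∈ V.image (namePrefix b ++ ·)) : ∃ w, v = false :: w := by
  obtain ⟨w, -, rfl⟩ := Finset.mem_image.1 h
  exact ⟨b :: w, rfl⟩

/-- The prefixes differ in their second bit; `signVar` is too short to carry a prefix, and the name
of the first state begins with `true`. -/
theorem mem_three_blocks {α₁ α₂ ρ : Finset PropVar} (hρ : ρ ⊆ {signVar, auxVar .state 0}) :
    (∀ v, namePrefix false ++ v ∈ α₁.image (namePrefix false ++ ·) ∪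
        α₂.image (namePrefix true ++ ·) ∪ ρ ↔ v ∈ α₁) ∧
      (∀ v, namePrefix true ++ v ∈ α₁.image (namePrefix false ++ ·) ∪
        α₂.image (namePrefix true ++ ·) ∪ ρ ↔ v ∈ α₂) ∧
      (∀ v ∈ ({signVar, auxVar .state 0} : Finset PropVar),
        v ∈ α₁.image (namePrefix false ++ ·) ∪ α₂.image (namePrefix true ++ ·) ∪ ρ ↔ v ∈ ρ) := by
  have h0 : ∀ b v, namePrefix b ++ v ∉ ρ := by
    intro b v h
    have := hρ h
    simp [namePrefix, signVar, auxVar, AuxSort.code] at this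
  refine ⟨fun v => ?_, fun v => ?_, fun v hv => ?_⟩
  · simp only [Finset.mem_union, append_mem_image, h0, or_false]
    simp [namePrefix]
  · simp only [Finset.mem_union, append_mem_image, h0, or_false]
    simp [namePrefix]
  · have h1 : ∀ b V, v ∉ Finset.image (namePrefix b ++ ·) V := fun b V h =>
      Finset.disjoint_left.1 (disjoint_image_pair b V) h hv
    simp only [Finset.mem_union, h1, false_or]

/-- A cnf whose models, with the sign of `signVar` and of the first state, are counted by the number
of models of `φ`. -/
def signedCNF (φ : NormalForm) : NormalForm :=
  relabel [] (namePrefix true) false φ ++ [[(signVar, false)], [(auxVar .state 0, false)]]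

/-- A cnf whose models, with the sign of `signVar` and of the first state, are counted by the
difference of the numbers of models of the dnfs `ψ` and `φ`. -/
def signedDNF (φ ψ : NormalForm) : NormalForm :=
  (relabel [(signVar, true), (auxVar .state 0, true)] (namePrefix false) true φ ++
    relabel [(signVar, false), (auxVar .state 0, true)] (namePrefix true) true ψ) ++
  (occurrences [(signVar, false)] (namePrefix false) false φ ++
    occurrences [(signVar, true)] (namePrefix true) false ψ)

/-- The empty left block fits the single cnf into the common evaluation
`cnfCount_twoCNF_sub_of_vars`. -/
theorem vars_signedCNF (φ : NormalForm) : vars (signedCNF φ) ∪ {signVar, auxVar .state 0} =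
    (∅ : Finset PropVar).image (namePrefix false ++ ·) ∪ φ.vars.image (namePrefix true ++ ·) ∪
      {signVar, auxVar .state 0} := by
  have h2 : vars [[(signVar, false)], [(auxVar .state 0, false)]] =
      {signVar, auxVar .state 0} := by
    ext v
    simp [vars]
  rw [signedCNF, vars_append, vars_relabel_nil, h2, Finset.union_assoc, Finset.union_self,
    Finset.image_empty, Finset.empty_union]

/-- The pair is added because it need not occur when both dnfs are empty. -/
theorem vars_signedDNF (φ ψ : NormalForm) : vars (signedDNF φ ψ) ∪ {signVar, auxVar .state 0} =
    φ.vars.image (namePrefix false ++ ·) ∪ ψ.vars.image (namePrefix true ++ ·) ∪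
      {signVar, auxVar .state 0} := by
  have he : ∀ b c, vars [[(signVar, b), (auxVar .state 0, c)]] = {signVar, auxVar .state 0} := by
    intro b c
    ext v
    simp [vars]
  have he' : ∀ b, vars [[(signVar, b)]] ⊆ {signVar, auxVar .state 0} := by
    intro b v
    simp only [vars]
    simp
    tauto
  rw [signedDNF, vars_append, vars_append, vars_append]
  have h1 := vars_relabel_subset [(signVar, true), (auxVar .state 0, true)]
    (namePrefix false) true φ
  have h2 := vars_relabel_subset [(signVar, false), (auxVar .state 0, true)]
    (namePrefix true) true ψ
  have h3 := vars_occurrences_subset [(signVar, false)] (namePrefix false) false φ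
  have h4 := vars_occurrences_subset [(signVar, true)] (namePrefix true) false ψ
  have h5 := image_subset_vars_relabel [(signVar, true), (auxVar .state 0, true)]
    (namePrefix false) true φ
  have h6 := image_subset_vars_relabel [(signVar, false), (auxVar .state 0, true)]
    (namePrefix true) true ψ
  have h7 := he' true
  have h8 := he' false
  rw [he] at h1 h2
  ext v
  specialize @h1 v
  specialize @h2 v
  specialize @h3 v
  specialize @h4 v
  specialize @h5 v
  specialize @h6 v
  specialize @h7 v
  specialize @h8 v
  simp only [Finset.mem_union] at h1 h2 h3 h4 h5 h6 h7 h8 ⊢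
  clear he he'
  grind

/-- The sum over the models of a formula whose variables come from three blocks. -/
theorem cnfCount_twoCNF_sub_of_vars {χ : NormalForm} {V W : Finset PropVar}
    (h : vars χ ∪ {signVar, auxVar .state 0} = V.image (namePrefix false ++ ·) ∪
      W.image (namePrefix true ++ ·) ∪ {signVar, auxVar .state 0}) :
    (cnfCount (twoCNF false χ) : ℤ) - cnfCount (twoCNF true χ) =
      ∑ α₁ ∈ V.powerset, ∑ α₂ ∈ W.powerset, ∑ ρ ∈ ({signVar, auxVar .state 0} : Finset _).powerset,
        ind (CNFModel (α₁.image (namePrefix false ++ ·) ∪ α₂.image (namePrefix true ++ ·) ∪ ρ) χ) *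
          (sign (auxVar .state 0 ∈ ρ) * sign (signVar ∈ ρ)) := by
  rw [cnfCount_twoCNF_sub, h, sum_powerset_union, sum_powerset_union, sum_powerset_image]
  · refine Finset.sum_congr rfl fun α₁ _ => ?_
    rw [sum_powerset_image]
    refine Finset.sum_congr rfl fun α₂ _ => Finset.sum_congr rfl fun ρ hρ => ?_
    obtain ⟨-, -, h3⟩ := mem_three_blocks (α₁ := α₁) (α₂ := α₂) (Finset.mem_powerset.1 hρ)
    rw [h3 signVar (by simp), h3 (auxVar .state 0) (by simp)]
  · exact disjoint_image_namePrefix _ _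
  · exact Finset.disjoint_union_left.2 ⟨disjoint_image_pair _ _, disjoint_image_pair _ _⟩
  · intro v hv
    have hv' := h ▸ Finset.mem_union_left {signVar, auxVar .state 0} hv
    simp only [Finset.mem_union, Finset.mem_insert, Finset.mem_singleton] at hv'
    rcases hv' with (hv' | hv') | rfl | rfl
    · exact .inr (image_of_namePrefix_mem hv')
    · exact .inr (image_of_namePrefix_mem hv')
    · exact .inr ⟨[], rfl⟩
    · exact .inl rfl

theorem cnfCount_signedCNF (φ : NormalForm) :
    (cnfCount (twoCNF false (signedCNF φ)) : ℤ) - cnfCount (twoCNF true (signedCNF φ)) =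
      cnfCount φ := by
  classical
  rw [cnfCount_twoCNF_sub_of_vars (vars_signedCNF φ), Finset.powerset_empty, Finset.sum_singleton,
    cast_cnfCount]
  refine Finset.sum_congr rfl fun α _ => ?_
  have key : ∀ ρ ∈ ({signVar, auxVar .state 0} : Finset PropVar).powerset,
      CNFModel ((∅ : Finset PropVar).image (namePrefix false ++ ·) ∪
        α.image (namePrefix true ++ ·) ∪ ρ) (signedCNF φ) ↔
      CNFModel α φ ∧ signVar ∉ ρ ∧ auxVar .state 0 ∉ ρ := by
    intro ρ hρ
    obtain ⟨-, h2, h3⟩ := mem_three_blocks (α₁ := ∅) (α₂ := α) (Finset.mem_powerset.1 hρ)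
    rw [signedCNF, cnfModel_append, cnfModel_relabel_false h2]
    simp only [CNFModel, List.mem_cons, List.not_mem_nil, or_false, forall_eq_or_imp, forall_eq,
      exists_eq_left, LitTrue, Bool.false_eq_true, if_false,
      h3 signVar (by simp), h3 (auxVar .state 0) (by simp)]
  rw [Finset.sum_congr rfl fun ρ hρ => by rw [key ρ hρ], sum_powerset_pair]
  simp [signVar_ne_state, signVar_ne_state.symm, ind_eq_ite, sign_eq_ite]

theorem sum_ind_eq_empty (V : Finset PropVar) :
    ∑ α ∈ V.powerset, ind (α = ∅) = 1 := by
  simp [ind_eq_ite]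

/-- If `signVar` is true, the variables of `φ` are frozen at false and the condition is: first state
or not `ψ`. The sum over the first state is [not `ψ`] - 1 = -[`ψ`], and the sign of `signVar` makes
it +[`ψ`]. If `signVar` is false, the roles are exchanged and the result is -[`φ`]. -/
theorem cnfCount_signedDNF (φ ψ : NormalForm) :
    (cnfCount (twoCNF true (signedDNF φ ψ)) : ℤ) - cnfCount (twoCNF false (signedDNF φ ψ)) =
      dnfCount φ - dnfCount ψ := by
  classical
  -- The general formula is for the opposite order of the two counts.
  rw [← neg_inj, neg_sub, neg_sub, cnfCount_twoCNF_sub_of_vars (vars_signedDNF φ ψ)]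
  have key : ∀ α₁ ∈ φ.vars.powerset, ∀ α₂ ∈ ψ.vars.powerset,
      ∑ ρ ∈ ({signVar, auxVar .state 0} : Finset PropVar).powerset,
        ind (CNFModel (α₁.image (namePrefix false ++ ·) ∪ α₂.image (namePrefix true ++ ·) ∪ ρ)
          (signedDNF φ ψ)) * (sign (auxVar .state 0 ∈ ρ) * sign (signVar ∈ ρ)) =
      ind (α₁ = ∅) * ind (DNFModel α₂ ψ) - ind (DNFModel α₁ φ) * ind (α₂ = ∅) := by
    intro α₁ hα₁ α₂ hα₂
    rw [Finset.mem_powerset] at hα₁ hα₂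
    have model : ∀ ρ ∈ ({signVar, auxVar .state 0} : Finset PropVar).powerset,
        CNFModel (α₁.image (namePrefix false ++ ·) ∪ α₂.image (namePrefix true ++ ·) ∪ ρ)
          (signedDNF φ ψ) ↔
        (((signVar ∈ ρ ∨ auxVar .state 0 ∈ ρ) ∨ ¬ DNFModel α₁ φ) ∧
          ((signVar ∉ ρ ∨ auxVar .state 0 ∈ ρ) ∨ ¬ DNFModel α₂ ψ)) ∧
          (signVar ∉ ρ ∨ α₁ = ∅) ∧ (signVar ∈ ρ ∨ α₂ = ∅) := by
      intro ρ hρ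
      obtain ⟨h1, h2, h3⟩ := mem_three_blocks (α₁ := α₁) (α₂ := α₂) (Finset.mem_powerset.1 hρ)
      rw [signedDNF, cnfModel_append, cnfModel_append, cnfModel_append, cnfModel_relabel_true h1,
        cnfModel_relabel_true h2, cnfModel_occurrences_false h1 _ hα₁,
        cnfModel_occurrences_false h2 _ hα₂]
      simp only [List.mem_cons, List.not_mem_nil, or_false, exists_eq_or_imp, exists_eq_left,
        LitTrue, Bool.false_eq_true, if_false, if_true, h3 signVar (by simp),
        h3 (auxVar .state 0) (by simp)]
    rw [Finset.sum_congr rfl fun ρ hρ => by rw [model ρ hρ], sum_powerset_pair]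
    generalize DNFModel α₁ φ = D₁, DNFModel α₂ ψ = D₂, (α₁ = ∅) = E₁, (α₂ = ∅) = E₂
    by_cases d1 : D₁ <;> by_cases d2 : D₂ <;> by_cases e1 : E₁ <;> by_cases e2 : E₂ <;>
      simp [signVar_ne_state, signVar_ne_state.symm, ind_eq_ite, sign_eq_ite, d1, d2, e1, e2]
  rw [Finset.sum_congr rfl fun α₁ h₁ => Finset.sum_congr rfl fun α₂ h₂ => key α₁ h₁ α₂ h₂]
  simp only [Finset.sum_sub_distrib, ← Finset.mul_sum, ← Finset.sum_mul, sum_ind_eq_empty,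
    ← cast_dnfCount, one_mul, mul_one]

/-! ### From cnfs to dnfs -/

/-- The dnf of which all assignments are models, except those that satisfy `ψ` and set the variables
of `φ` to false. -/
def complementLeft (φ ψ : NormalForm) : NormalForm :=
  occurrences [] (namePrefix false) true φ ++ relabel [] (namePrefix true) true ψ

/-- The dnf of which all assignments are models, except those that satisfy `φ` and set the variables
of `ψ` to false. -/
def complementRight (φ ψ : NormalForm) : NormalForm :=
  relabel [] (namePrefix false) true φ ++ occurrences [] (namePrefix true) true ψ

/-- Both dnfs have the same variables. The first misses one assignment for each model of `ψ`, the
second one for each model of `φ`. -/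
theorem dnfCount_complement_sub (φ ψ : NormalForm) :
    (dnfCount (complementLeft φ ψ) : ℤ) - dnfCount (complementRight φ ψ) =
      cnfCount φ - cnfCount ψ := by
  classical
  rw [cast_dnfCount, cast_dnfCount, complementLeft, complementRight, vars_append, vars_append,
    vars_relabel_nil, vars_relabel_nil, vars_occurrences_nil, vars_occurrences_nil,
    ← Finset.sum_sub_distrib, sum_powerset_union (disjoint_image_namePrefix _ _),
    sum_powerset_image]
  have key : ∀ α₁ ∈ φ.vars.powerset, ∑ β ∈ (ψ.vars.image (namePrefix true ++ ·)).powerset,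
      (ind (DNFModel (α₁.image (namePrefix false ++ ·) ∪ β) (complementLeft φ ψ)) -
        ind (DNFModel (α₁.image (namePrefix false ++ ·) ∪ β) (complementRight φ ψ))) =
      ∑ α₂ ∈ ψ.vars.powerset, (ind (CNFModel α₁ φ) * ind (α₂ = ∅) -
        ind (α₁ = ∅) * ind (CNFModel α₂ ψ)) := by
    intro α₁ hα₁
    rw [sum_powerset_image]
    refine Finset.sum_congr rfl fun α₂ hα₂ => ?_
    rw [Finset.mem_powerset] at hα₁ hα₂
    obtain ⟨h1, h2, -⟩ := mem_three_blocks (α₁ := α₁) (α₂ := α₂) (Finset.empty_subset _)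
    rw [Finset.union_empty] at h1 h2
    rw [complementLeft, complementRight, dnfModel_append, dnfModel_append,
      dnfModel_relabel_true h1, dnfModel_relabel_true h2, dnfModel_occurrences_true h1 hα₁,
      dnfModel_occurrences_true h2 hα₂, ne_eq, ne_eq]
    generalize CNFModel α₁ φ = D₁, CNFModel α₂ ψ = D₂, (α₁ = ∅) = E₁, (α₂ = ∅) = E₂
    by_cases d1 : D₁ <;> by_cases d2 : D₂ <;> by_cases e1 : E₁ <;> by_cases e2 : E₂ <;>
      simp [ind_eq_ite, d1, d2, e1, e2]
  rw [complementLeft, complementRight] at key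
  rw [Finset.sum_congr rfl key]
  simp only [Finset.sum_sub_distrib, ← Finset.mul_sum, ← Finset.sum_mul, sum_ind_eq_empty,
    ← cast_cnfCount, one_mul, mul_one]

end NormalForm

/-! ## The reductions -/

open NormalForm

theorem LogspaceComputable.map {α β γ : Type} [Finite β] [Finite γ] {h : List α → List β}
    (hh : LogspaceComputable h) (f : β → γ) : LogspaceComputable fun x => (h x).map f := by
  simpa [List.flatMap_singleton, ← List.map_eq_flatMap] using hh.flatMap fun b => [f b]

/-- The disjoint alphabets allow one homomorphism to treat the two components of a pair differently.
-/
theorem flatMap_sum_elim {A B C : Type} (u : List A) (v : List B) (f : A → List C)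
    (g : B → List C) : (u.map Sum.inl ++ v.map Sum.inr).flatMap (Sum.elim f g) =
      u.flatMap f ++ v.flatMap g := by
  simp [List.flatMap_append, List.flatMap_map]

namespace CountingProblem

/-- A problem is reducible to `#2SAT - #2SAT` if its values are differences of the numbers of models
of `twoCNF b χ` and `twoCNF (!b) χ`, where `χ` is computed in logarithmic space. -/
theorem logspaceReducible_of_twoCNF {P : CountingProblem} (b : Bool)
    {h : List P.Sym → List Symbol} (hh : LogspaceComputable h)
    (hP : ∀ x, ∃ χ, h (P.encode x) = NormalForm.encode χ ∧
      P.value x = cnfCount (twoCNF b χ) - cnfCount (twoCNF (!b) χ)) :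
    LogspaceReducible P (sharp2SAT - sharp2SAT) := by
  obtain ⟨h₁, hh₁, e₁⟩ := exists_logspaceComputable_twoCNF hh b
  obtain ⟨h₂, hh₂, e₂⟩ := exists_logspaceComputable_twoCNF hh (!b)
  refine ⟨fun x => (h₁ x).map Sum.inl ++ (h₂ x).map Sum.inr, (hh₁.map Sum.inl).append
    (hh₂.map Sum.inr), fun x => ?_⟩
  obtain ⟨χ, hχ, hv⟩ := hP x
  refine ⟨(⟨twoCNF b χ, isTwo_twoCNF b χ⟩, ⟨twoCNF (!b) χ, isTwo_twoCNF (!b) χ⟩), ?_, hv⟩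
  simp only [e₁ _ _ hχ, e₂ _ _ hχ]
  rfl

theorem sharpSAT_reducible : LogspaceReducible sharpSAT (sharp2SAT - sharp2SAT) := by
  refine logspaceReducible_of_twoCNF false (h := fun x : List Symbol =>
    x.flatMap (relabelSymbol [] (namePrefix true) false) ++
      NormalForm.encode [[(signVar, false)], [(auxVar .state 0, false)]])
    (((LogspaceComputable.id (α := Symbol)).flatMap _).append (.const _)) fun φ =>
      ⟨signedCNF φ, ?_, (cnfCount_signedCNF φ).symm⟩
  refine (congrArg (· ++ _) (flatMap_relabelSymbol _ _ _ φ)).trans ?_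
  simp [signedCNF, NormalForm.encode]

theorem reducible_sharp2SAT_of_sharp2DNF {P : CountingProblem}
    (hP : LogspaceReducible P (sharp2DNF - sharp2DNF)) :
    LogspaceReducible P (sharp2SAT - sharp2SAT) := by
  obtain ⟨h, hh, hv⟩ := hP
  change List P.Sym → List (Symbol ⊕ Symbol) at h
  change @LogspaceComputable P.Sym (Symbol ⊕ Symbol) h at hh
  -- The output of `h` is generated twice, once for the relabelled formulas and once for the clauses
  -- that freeze variables. The value `true` gives the order in which the sign is right.
  refine logspaceReducible_of_twoCNF true (h := fun x =>
    (h x).flatMap (Sum.elim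
      (relabelSymbol [(signVar, true), (auxVar .state 0, true)] (namePrefix false) true)
      (relabelSymbol [(signVar, false), (auxVar .state 0, true)] (namePrefix true) true)) ++
    (h x).flatMap (Sum.elim (occurrencesSymbol [(signVar, false)] (namePrefix false) false)
      (occurrencesSymbol [(signVar, true)] (namePrefix true) false)))
    ((hh.flatMap _).append (hh.flatMap _)) fun x => ?_
  obtain ⟨⟨φ, ψ⟩, hx, hxv⟩ := hv x
  refine ⟨signedDNF φ.1 ψ.1, ?_, hxv.trans (cnfCount_signedDNF φ.1 ψ.1).symm⟩
  have hx' : h (P.encode x) =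
    (NormalForm.encode φ.1).map Sum.inl ++ (NormalForm.encode ψ.1).map Sum.inr := hx
  simp only [hx', flatMap_sum_elim, flatMap_relabelSymbol, flatMap_occurrencesSymbol]
  simp [signedDNF, NormalForm.encode]

theorem reducible_sharp2DNF_of_sharp2SAT {P : CountingProblem}
    (hP : LogspaceReducible P (sharp2SAT - sharp2SAT)) :
    LogspaceReducible P (sharp2DNF - sharp2DNF) := by
  obtain ⟨h, hh, hv⟩ := hP
  change List P.Sym → List (Symbol ⊕ Symbol) at h
  change @LogspaceComputable P.Sym (Symbol ⊕ Symbol) h at hh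
  let h' : List P.Sym → List (Symbol ⊕ Symbol) := fun x =>
    ((h x).flatMap (Sum.elim (occurrencesSymbol [] (namePrefix false) true)
      (relabelSymbol [] (namePrefix true) true))).map Sum.inl ++
    ((h x).flatMap (Sum.elim (relabelSymbol [] (namePrefix false) true)
      (occurrencesSymbol [] (namePrefix true) true))).map Sum.inr
  have hh' : LogspaceComputable h' := ((hh.flatMap _).map _).append ((hh.flatMap _).map _)
  refine ⟨h', hh', fun x => ?_⟩
  obtain ⟨⟨φ, ψ⟩, hx, hxv⟩ := hv x
  refine ⟨(⟨complementLeft φ.1 ψ.1, isTwo_append (isTwo_occurrences _ _ _) (isTwo_relabel _ _ ψ.2)⟩,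
    ⟨complementRight φ.1 ψ.1, isTwo_append (isTwo_relabel _ _ φ.2) (isTwo_occurrences _ _ _)⟩), ?_,
    hxv.trans (dnfCount_complement_sub φ.1 ψ.1).symm⟩
  have hx' : h (P.encode x) =
    (NormalForm.encode φ.1).map Sum.inl ++ (NormalForm.encode ψ.1).map Sum.inr := hx
  have e : ∀ χ χ' : NormalForm, NormalForm.encode χ ++ NormalForm.encode χ' =
      NormalForm.encode (χ ++ χ') := by
    intro χ χ'
    simp [NormalForm.encode]
  simp only [h', hx', flatMap_sum_elim, flatMap_relabelSymbol, flatMap_occurrencesSymbol, e]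
  rfl

end CountingProblem

theorem mainTheorem3 :
    sharpSAT ∈ CountingProblem.logClosure (sharp2SAT - sharp2SAT) ∧
      CountingProblem.logClosure (sharp2SAT - sharp2SAT) =
        CountingProblem.logClosure (sharp2DNF - sharp2DNF) :=
  ⟨CountingProblem.sharpSAT_reducible, Set.ext fun _ =>
    ⟨CountingProblem.reducible_sharp2DNF_of_sharp2SAT,
      CountingProblem.reducible_sharp2SAT_of_sharp2DNF⟩⟩
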